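/- **Model.** Let $L,n,k$ be natural numbers with $k>1$ and $n\ge L+k-1$, and let $\mu>0$. Each file is stored as $n$ chunks, any $k$ of which suffice to restore it. Requests $i=1,2,\dots$ arrive at random times $0\le T_A^1\le T_A^2\le\cdots\to\infty$ (any law); let $N_T$ be the number of arrivals in $[0,T]$. A dispatcher has $L$ threads. A scheduling scheme chooses the starting times $T_S^{i,1}\le\dots\le T_S^{i,n}\in[0,\infty]$ of the threads of request $i$ ($\infty$ meaning "never started"). The $j$-th thread of request $i$ downloads its own chunk of the file and needs the time $X_{i,j}$, so it would finish at $T_F^{i,j}=T_S^{i,j}+X_{i,j}$. Request $i$ departs at the $k$-th smallest of $T_F^{i,1},\dots,T_F^{i,n}$, called $T_F^i$, and its threads still in progress are then terminated; downloads are not interrupted otherwise. No thread is started for a request before its arrival or after its departure, and at most $L$ threads are active at any time. The scheme is *on-line* if its decisions up to any time $t$ depend (measurably) only on the arrivals and the successful downloads up to time $t$ and on an independent random seed. The $X_{i,j}$ are i.i.d. exponential with rate $\mu$; they, the arrival process and the seed are independent. The delay of request $i$ is $D_i=T_F^i-T_A^i\in[0,\infty]$. The *greedy* scheme is the one under which,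 whenever a request is in the system, all $L$ threads are downloading chunks of the head-of-line request (the earliest arrived one that has not departed), a thread which finishes a chunk starting at once on another chunk of the same file until $k$ chunks have arrived. **Theorem 3.** The greedy scheme exists as an on-line scheme, and it is delay optimal: for every arrival process as above and every on-line scheme $\pi$, $$\mathbb{E}_{\text{greedy}}[D]\le\mathbb{E}_{\pi}[D].$$ Here $\mathbb{E}_{\pi}[D]\in[0,\infty]$ is the long-run average expected delay, and the inequality holds in each of the following readings: $\mathbb{E}_\pi[D]=\lim_{T\to\infty}\mathbb{E}_\pi\big[\frac1{N_T}\sum_{i=1}^{N_T}D_i\big]$, or $\mathbb{E}_\pi[D]=\lim_{N\to\infty}\frac1N\sum_{i=1}^{N}\mathbb{E}_\pi[D_i]$, the limit being replaced on both sides by the limit superior, or on both sides by the limit inferior, so that no existence of limits is assumed (an average over no requests counts as $0$). -/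

import Mathlib

open MeasureTheory ProbabilityTheory Filter
open scoped NNReal ENNReal Topology

/-- A sample of everything random in the system: the arrival times `arr i` of the requests
`i = 0, 1, 2, …`, the downloading times `dl (i, j)` of the `j`-th thread allocated to request `i`,
and a seed used by the dispatcher for randomized decisions. -/
structure Sample (n : ℕ) (U : Type*) where
  arr : ℕ → ℝ≥0
  dl : ℕ × Fin n → ℝ
  seed : U

namespace Sample

variable {n : ℕ} {U : Type*}

/-- The components of a sample, as a triple. -/
def toTriple (ω : Sample n U) : (ℕ → ℝ≥0) × (ℕ × Fin n → ℝ) × U := (ω.arr, ω.dl, ω.seed)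

/-- The product σ-algebra on samples. -/
instance [MeasurableSpace U] : MeasurableSpace (Sample n U) :=
  MeasurableSpace.comap toTriple inferInstance

/-- An arrival path: requests are numbered in order of arrival (simultaneous arrivals are allowed)
and only finitely many of them arrive in each bounded period. -/
def IsArrivalPath (a : ℕ → ℝ≥0) : Prop := Monotone a ∧ Tendsto a atTop atTop

/-- A regular sample: an arrival path together with positive downloading times. -/
def Regular (ω : Sample n U) : Prop := IsArrivalPath ω.arr ∧ ∀ p, 0 < ω.dl p

end Sample

/-- Two families of event times (`∞` means that the event never happens) look the same to an
observer who has watched the system up to and including time `t`. -/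
def AgreeUpTo {ι : Type*} (t : ℝ≥0) (f g : ι → ℝ≥0∞) : Prop :=
  ∀ i, f i ≤ t ∨ g i ≤ t → f i = g i

/-- A rule which prescribes, for every sample, the time `S ω (i, j)` at which the `j`-th thread
of request `i` is started; the value `∞` means that this thread is never started. -/
abbrev StartRule (n : ℕ) (U : Type*) := Sample n U → ℕ × Fin n → ℝ≥0∞

namespace StartRule

variable {n : ℕ} {U : Type*} (k : ℕ) (S : StartRule n U) (ω : Sample n U)

/-- The time at which the download of a thread would finish if it were never terminated. -/
noncomputable def finish (p : ℕ × Fin n) : ℝ≥0∞ := S ω p + ENNReal.ofReal (ω.dl p)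

/-- The departure time of request `i`: the `k`-th smallest of the finishing times of its threads
(`∞` if fewer than `k` of them ever finish). -/
noncomputable def departure (i : ℕ) : ℝ≥0∞ :=
  sInf {t : ℝ≥0∞ | (k : ℕ∞) ≤ {j : Fin n | S.finish ω (i, j) ≤ t}.encard}

/-- The `j`-th thread of request `i`, `p = (i, j)`, is downloading at time `t`: it has been started,
it has not finished, and it has not been terminated by the departure of its request. -/
def Active (t : ℝ≥0) (p : ℕ × Fin n) : Prop :=
  S ω p ≤ t ∧ t < S.finish ω p ∧ t < S.departure k ω p.1

open Classical in
/-- The time at which the dispatcher sees the download of a thread succeed; it is `∞` for a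
thread which is never started or which is terminated by the departure of its request. -/
noncomputable def observed (p : ℕ × Fin n) : ℝ≥0∞ :=
  if S.finish ω p ≤ S.departure k ω p.1 then S.finish ω p else ⊤

/-- The delay of request `i`. -/
noncomputable def delay (i : ℕ) : ℝ≥0∞ := S.departure k ω i - ω.arr i

/-- Request `i` is at the head of the line at time `t`: it is the earliest request among those
that have arrived and not departed. -/
def HeadOfLine (t : ℝ≥0) (i : ℕ) : Prop :=
  ω.arr i ≤ t ∧ t < S.departure k ω i ∧ ∀ i' < i, S.departure k ω i' ≤ t

end StartRule

/-- On-line (possibly randomized, possibly idling) scheduling schemes for a dispatcher with `L`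
threads and files stored with an `(n, k)` code. -/
structure OnlineScheme (L n k : ℕ) (U : Type*) [MeasurableSpace U] where
  /-- the starting times of the threads -/
  start : StartRule n U
  measurable_start : ∀ p, Measurable fun ω => start ω p
  /-- no thread is allocated to a request before its arrival -/
  arr_le_start : ∀ ω : Sample n U, ω.Regular → ∀ i j, (ω.arr i : ℝ≥0∞) ≤ start ω (i, j)
  /-- the threads of a request are numbered by their starting times -/
  start_mono : ∀ ω : Sample n U, ω.Regular → ∀ i, Monotone fun j => start ω (i, j)
  /-- no thread is allocated to a request that has departed -/
  start_lt_departure : ∀ ω : Sample n U, ω.Regular → ∀ i j,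
    start ω (i, j) < ⊤ → start ω (i, j) < start.departure k ω i
  /-- at most `L` threads are active at any time -/
  card_active_le : ∀ ω : Sample n U, ω.Regular → ∀ t : ℝ≥0,
    {p | start.Active k ω t p}.encard ≤ L
  /-- the decisions up to time `t` depend only on the seed and on what has been observed up to
  time `t`: the arrivals and the successful downloads -/
  nonanticipative : ∀ ω ω' : Sample n U, ω.Regular → ω'.Regular → ω.seed = ω'.seed →
    ∀ t : ℝ≥0, AgreeUpTo t (fun i => (ω.arr i : ℝ≥0∞)) (fun i => (ω'.arr i : ℝ≥0∞)) →
      AgreeUpTo t (start.observed k ω) (start.observed k ω') →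
      AgreeUpTo t (start ω) (start ω')

/-- The law of a sample: the downloading times are i.i.d. exponential with rate `μ`, and they, the
arrival process (with law `α`) and the seed (with law `ν`) are independent. -/
noncomputable def sampleLaw (n : ℕ) {U : Type*} [MeasurableSpace U] (μ : ℝ)
    (α : Measure (ℕ → ℝ≥0)) (ν : Measure U) : Measure (Sample n U) :=
  (α.prod ((Measure.infinitePi fun _ : ℕ × Fin n => expMeasure μ).prod ν)).map
    fun x => ⟨x.1, x.2.1, x.2.2⟩

/-- The number `N_T` of requests that arrive during `[0, T]`. -/
noncomputable def numArrivals (a : ℕ → ℝ≥0) (T : ℝ≥0) : ℕ := {i | a i ≤ T}.ncard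

namespace OnlineScheme

variable {L n k : ℕ} {U : Type*} [MeasurableSpace U]

/-- The greedy scheme: at any time, all `L` threads are downloading chunks of the head-of-line
request and none is allocated to any other request. -/
def IsGreedy (σ : OnlineScheme L n k U) : Prop :=
  ∀ ω : Sample n U, ω.Regular → ∀ (t : ℝ≥0) (i : ℕ), σ.start.HeadOfLine k ω t i →
    {j | σ.start.Active k ω t (i, j)}.encard = L ∧
      ∀ i' j, i' ≠ i → ¬ σ.start.Active k ω t (i', j)

/-- The expected average delay of the requests that arrive during `[0, T]`. -/
noncomputable def horizonDelay (σ : OnlineScheme L n k U) (μ : ℝ) (α : Measure (ℕ → ℝ≥0))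
    (ν : Measure U) (T : ℝ≥0) : ℝ≥0∞ :=
  ∫⁻ ω, (∑ i ∈ Finset.range (numArrivals ω.arr T), σ.start.delay k ω i) / numArrivals ω.arr T
    ∂(sampleLaw n μ α ν)

/-- The average of the expected delays of the first `N` requests. -/
noncomputable def requestDelay (σ : OnlineScheme L n k U) (μ : ℝ) (α : Measure (ℕ → ℝ≥0))
    (ν : Measure U) (N : ℕ) : ℝ≥0∞ :=
  (∑ i ∈ Finset.range N, ∫⁻ ω, σ.start.delay k ω i ∂(sampleLaw n μ α ν)) / N

end OnlineScheme

/-!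
For fixed arrivals and seed, the starting times of the threads are functions of the downloading
times, and an on-line scheme is causal (`OnlineScheme.causal`): prolonging one download changes
nothing that happens before this download would have finished. Resampling a single downloading time
and integrating by parts against its exponential law therefore shows that each active thread
finishes with intensity `μ`, whatever the scheme (`lintegral_completion`).

The comparison rests on the backlog, the number `W` of chunks of the first `N` requests that are
still missing, future requests included (`backlog`). It falls by one whenever a useful download
succeeds, so it leaves each level `m` with intensity `μ` times the number of active threads
(`measure_backlog_crossing`). This number is at most `L`, and it is `0` if all missing chunks belong
to future requests, which is decided by `m` and the arrivals alone. For the greedy scheme it is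
exactly `L` in all other cases. Hence the tails `P (W ≥ m)` satisfy integral inequalities which,
by downward induction on `m`, make the greedy backlog stochastically minimal at every time
(`tail_le_tail_of_drift`, `OnlineScheme.IsGreedy.measure_le_backlogOf`).

A request in the system misses at most `k` chunks, so more than `r` of the first `N` requests are in
the system if more than `r * k` chunks are missing from them. Under the greedy scheme the converse
holds too, because of the requests in the system only the one at the head of the line has received
any chunks. So the expected queue length is minimal under the greedy scheme at every time. The total
delay of the first `N` requests is the time integral of their queue length
(`OnlineScheme.sum_delay_eq_lintegral`), whence the expected total delay is minimal for every `N`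
and all arrivals, and both averages compare term by term, before any limit is taken.

The greedy scheme itself is built request by request: a thread starts at the first time at which
fewer than `L` of the previous threads of the request are in progress (`greedyStart`). The bound
`L + k - 1 ≤ n` says that a request never runs out of threads.
-/

/-! ### Order statistics of event times -/

/-- The number of members of a finite family of event times that are at most `t`. -/
noncomputable def numLE {ι : Type*} [Fintype ι] (f : ι → ℝ≥0∞) (t : ℝ≥0∞) : ℕ :=
  (Finset.univ.filter fun j => f j ≤ t).card

/-- The `m`-th smallest member of a family of event times (`0` if `m = 0`, and `∞` if there are
fewer than `m` members). -/
noncomputable def orderStat {ι : Type*} (m : ℕ) (f : ι → ℝ≥0∞) : ℝ≥0∞ :=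
  sInf {t | (m : ℕ∞) ≤ {j | f j ≤ t}.encard}

section OrderStat

variable {ι : Type*} [Fintype ι]

lemma encard_setOf_le (f : ι → ℝ≥0∞) (t : ℝ≥0∞) : {j | f j ≤ t}.encard = (numLE f t : ℕ∞) := by
  rw [numLE, ← Set.encard_coe_eq_coe_finsetCard]
  simp

lemma numLE_mono (f : ι → ℝ≥0∞) : Monotone (numLE f) := fun _ _ h =>
  Finset.card_le_card fun j => by simpa using fun hj => le_trans hj h

lemma numLE_anti {f g : ι → ℝ≥0∞} (h : ∀ j, f j ≤ g j) (t : ℝ≥0∞) : numLE g t ≤ numLE f t :=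
  Finset.card_le_card fun j => by simpa using fun hj => le_trans (h j) hj

lemma numLE_congr {f g : ι → ℝ≥0∞} {s t : ℝ≥0∞} (h : ∀ j, f j ≤ s ↔ g j ≤ t) :
    numLE f s = numLE g t := by
  unfold numLE
  congr 1
  ext j
  simpa using h j

lemma measurable_numLE {α : Type*} [MeasurableSpace α] {f : α → ι → ℝ≥0∞} {t : α → ℝ≥0∞}
    (hf : ∀ j, Measurable fun a => f a j) (ht : Measurable t) :
    Measurable fun a => numLE (f a) (t a) := by
  unfold numLE
  simp only [Finset.card_filter]
  exact Finset.measurable_sum _ fun j _ =>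
    Measurable.ite (measurableSet_le (hf j) ht) measurable_const measurable_const

/-- Order statistics of finite families are attained, because counting functions are
right-continuous. -/
lemma orderStat_le_iff {m : ℕ} {f : ι → ℝ≥0∞} {t : ℝ≥0∞} (ht : t ≠ ⊤) :
    orderStat m f ≤ t ↔ m ≤ numLE f t := by
  constructor
  · intro h
    have hev : ∀ᶠ s in 𝓝[>] t, ∀ j, f j ≤ s → f j ≤ t := by
      rw [eventually_all]
      intro j
      by_cases hj : f j ≤ t
      · exact Eventually.of_forall fun _ _ => hj
      · push Not at hj
        filter_upwards [nhdsWithin_le_nhds (Iio_mem_nhds hj)] with s hs h'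
        exact absurd h' (not_le.2 hs)
    have : (𝓝[>] t).NeBot := nhdsGT_neBot_of_exists_gt ⟨⊤, lt_top_iff_ne_top.2 ht⟩
    obtain ⟨s, hs, hts⟩ := (hev.and self_mem_nhdsWithin).exists
    obtain ⟨r, hr, hrs⟩ := sInf_lt_iff.1 (lt_of_le_of_lt h hts)
    simp only [Set.mem_ofPred_eq, encard_setOf_le, Nat.cast_le] at hr
    refine hr.trans (Finset.card_le_card fun j => ?_)
    simpa using fun hj => hs j (hj.trans hrs.le)
  · intro h
    refine sInf_le ?_
    simpa [encard_setOf_le] using h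

lemma lt_orderStat_iff {m : ℕ} {f : ι → ℝ≥0∞} {t : ℝ≥0∞} (ht : t ≠ ⊤) :
    t < orderStat m f ↔ numLE f t < m := by
  rw [← not_le, orderStat_le_iff ht, not_le]

/-- A numeric function on a measurable space is measurable as soon as its finite sublevel sets
are. -/
lemma measurable_of_measurableSet_le {α : Type*} [MeasurableSpace α] {f : α → ℝ≥0∞}
    (h : ∀ t : ℝ≥0∞, t ≠ ⊤ → MeasurableSet {a | f a ≤ t}) : Measurable f := by
  refine measurable_of_Iic fun t => ?_
  by_cases ht : t = ⊤
  · simp [ht]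
  · exact h t ht

lemma measurable_orderStat {α : Type*} [MeasurableSpace α] {f : α → ι → ℝ≥0∞} (m : ℕ)
    (hf : ∀ j, Measurable fun a => f a j) : Measurable fun a => orderStat m (f a) := by
  refine measurable_of_measurableSet_le fun t ht => ?_
  simp only [orderStat_le_iff ht]
  exact measurableSet_le measurable_const (measurable_numLE hf measurable_const)

end OrderStat

namespace StartRule

variable {n : ℕ} {U : Type*} {k : ℕ} {S : StartRule n U} {ω : Sample n U} {i : ℕ}

lemma departure_le_iff {t : ℝ≥0∞} (ht : t ≠ ⊤) :
    S.departure k ω i ≤ t ↔ k ≤ numLE (fun j => S.finish ω (i, j)) t :=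
  orderStat_le_iff ht

lemma lt_departure_iff {t : ℝ≥0∞} (ht : t ≠ ⊤) :
    t < S.departure k ω i ↔ numLE (fun j => S.finish ω (i, j)) t < k :=
  lt_orderStat_iff ht

end StartRule

/-! ### The greedy service of a single request -/

section SingleRequest

variable {n : ℕ}

/-- The starting times of the threads of a single request whose service begins at time `b` and
whose threads take the times `x`: the thread `j` starts as soon as fewer than `L` of the threads
before it are unfinished, unless `k` chunks have arrived by then. The threads from `j` on are given
the finishing time `∞` in `g`, so that they do not count. -/
noncomputable def greedyStart (L k : ℕ) (b : ℝ≥0∞) (x : Fin n → ℝ≥0∞) (j : Fin n) : ℝ≥0∞ :=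
  let g : Fin n → ℝ≥0∞ := fun j' => if _ : j' < j then greedyStart L k b x j' + x j' else ⊤
  let s := b ⊔ orderStat (j + 1 - L) g
  if numLE g s < k then s else ⊤
termination_by j.val

/-- `s` is a family of greedy starting times if `s j` is the least finite time `t ≥ b` at which
fewer than `L` of the threads before `j` are unfinished and fewer than `k` of them have finished
(`∞` if there is no such time). -/
structure IsGreedyStart (L k : ℕ) (b : ℝ≥0∞) (x s : Fin n → ℝ≥0∞) : Prop where
  begin_le : ∀ j, b ≤ s j
  card_lt : ∀ j, s j ≠ ⊤ → j + 1 ≤ L + numLE (fun j' => if j' < j then s j' + x j' else ⊤) (s j)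
  card_lt_k : ∀ j, s j ≠ ⊤ → numLE (fun j' => if j' < j then s j' + x j' else ⊤) (s j) < k
  le_of : ∀ j t, t ≠ ⊤ → b ≤ t →
    j + 1 ≤ L + numLE (fun j' => if j' < j then s j' + x j' else ⊤) t →
    numLE (fun j' => if j' < j then s j' + x j' else ⊤) t < k → s j ≤ t

lemma isGreedyStart_greedyStart (L k : ℕ) (b : ℝ≥0∞) (x : Fin n → ℝ≥0∞) :
    IsGreedyStart L k b x (greedyStart L k b x) := by
  have key : ∀ j, greedyStart L k b x j =
      if numLE (fun j' => if j' < j then greedyStart L k b x j' + x j' else ⊤)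
        (b ⊔ orderStat (j + 1 - L)
          (fun j' => if j' < j then greedyStart L k b x j' + x j' else ⊤)) < k
      then b ⊔ orderStat (j + 1 - L)
          (fun j' => if j' < j then greedyStart L k b x j' + x j' else ⊤) else ⊤ := by
    intro j
    rw [greedyStart]
    simp only [dite_eq_ite]
  refine ⟨fun j => ?_, fun j hj => ?_, fun j hj => ?_, fun j t ht hb h1 h2 => ?_⟩
  · rw [key j]
    split_ifs <;> simp
  · have h := key j
    split_ifs at h with hlt
    · rw [h] at hj
      have := (orderStat_le_iff hj).1 (le_sup_right : _ ≤ b ⊔ _)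
      rw [h]
      omega
    · exact absurd h hj
  · have h := key j
    split_ifs at h with hlt
    · rw [h]
      exact hlt
    · exact absurd h hj
  · have hs : b ⊔ orderStat (j + 1 - L)
        (fun j' => if j' < j then greedyStart L k b x j' + x j' else ⊤) ≤ t :=
      sup_le hb ((orderStat_le_iff ht).2 (by omega))
    rw [key j, if_pos (lt_of_le_of_lt (numLE_mono _ hs) h2)]
    exact hs

lemma measurable_greedyStart {α : Type*} [MeasurableSpace α] (L k : ℕ) {b : α → ℝ≥0∞}
    {x : α → Fin n → ℝ≥0∞} (hb : Measurable b) (hx : ∀ j, Measurable fun a => x a j) (j : Fin n) :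
    Measurable fun a => greedyStart L k (b a) (x a) j := by
  induction j using WellFoundedLT.induction with
  | ind j ih =>
    have hg : ∀ j', Measurable fun a =>
        if j' < j then greedyStart L k (b a) (x a) j' + x a j' else ⊤ := by
      intro j'
      by_cases h : j' < j
      · simp only [h, if_true]
        exact (ih j' h).add (hx j')
      · simp only [h, if_false, measurable_const]
    have hs : Measurable fun a => b a ⊔ orderStat (j + 1 - L) fun j' =>
        if j' < j then greedyStart L k (b a) (x a) j' + x a j' else ⊤ :=
      hb.sup (measurable_orderStat (j + 1 - L) hg)
    have hunfold : ∀ a, greedyStart L k (b a) (x a) j = _ := fun a => by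
      rw [greedyStart]
    simp only [hunfold, dite_eq_ite]
    exact Measurable.ite (measurableSet_lt (measurable_numLE hg hs) measurable_const) hs
      measurable_const

namespace IsGreedyStart

variable {L k : ℕ} {b : ℝ≥0∞} {x s : Fin n → ℝ≥0∞}

lemma mono (h : IsGreedyStart L k b x s) : Monotone s := by
  cases n with
  | zero => intro i; exact i.elim0
  | succ n =>
  refine Fin.monotone_iff_le_succ.2 fun j => ?_
  by_cases hj : s j.succ = ⊤
  · simp [hj]
  have h1 := h.card_lt _ hj
  have h2 := h.card_lt_k _ hj
  have hle : numLE (fun j' => if j' < j.succ then s j' + x j' else ⊤) (s j.succ) ≤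
      numLE (fun j' => if j' < j.castSucc then s j' + x j' else ⊤) (s j.succ) + 1 := by
    unfold numLE
    refine le_trans (Finset.card_le_card fun j' => ?_) (Finset.card_insert_le j.castSucc _)
    simp only [Finset.mem_filter, Finset.mem_univ, true_and, Finset.mem_insert]
    intro hj'
    rcases lt_trichotomy j' j.castSucc with hlt | rfl | hgt
    · right
      rw [if_pos hlt]
      rwa [if_pos (hlt.trans Fin.castSucc_lt_succ)] at hj'
    · left; rfl
    · rw [if_neg (by rw [not_lt]; exact Fin.castSucc_lt_iff_succ_le.1 hgt)] at hj'
      exact absurd (top_le_iff.1 hj') hj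
  have hge : numLE (fun j' => if j' < j.castSucc then s j' + x j' else ⊤) (s j.succ) ≤
      numLE (fun j' => if j' < j.succ then s j' + x j' else ⊤) (s j.succ) := by
    refine numLE_anti (fun j' => ?_) _
    by_cases hlt : j' < j.castSucc
    · rw [if_pos hlt, if_pos (hlt.trans Fin.castSucc_lt_succ)]
    · simp [hlt]
  refine h.le_of _ _ hj (h.begin_le _) ?_ (hge.trans_lt h2)
  simp only [Fin.val_succ, Fin.val_castSucc] at h1 ⊢
  omega

/-- Only the threads before `j` can have finished when the thread `j` starts. -/
lemma numLE_before (h : IsGreedyStart L k b x s) (hx : ∀ j, 0 < x j) {j : Fin n} (hj : s j ≠ ⊤) :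
    numLE (fun j' => s j' + x j') (s j) =
      numLE (fun j' => if j' < j then s j' + x j' else ⊤) (s j) := by
  refine numLE_congr fun j' => ?_
  by_cases hlt : j' < j
  · simp [hlt]
  · simp only [hlt, if_false, top_le_iff, hj, iff_false, not_le]
    by_cases h' : s j' = ⊤
    · simpa [h'] using lt_top_iff_ne_top.2 hj
    · exact (h.mono (not_lt.1 hlt)).trans_lt (ENNReal.lt_add_right h' (hx j').ne')

lemma lt_orderStat (h : IsGreedyStart L k b x s) (hx : ∀ j, 0 < x j) {j : Fin n} (hj : s j ≠ ⊤) :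
    s j < orderStat k fun j' => s j' + x j' := by
  rw [lt_orderStat_iff hj, h.numLE_before hx hj]
  exact h.card_lt_k j hj

lemma card_active_le (h : IsGreedyStart L k b x s) {t : ℝ≥0∞} (ht : t ≠ ⊤) :
    (Finset.univ.filter fun j => s j ≤ t ∧ t < s j + x j).card ≤ L := by
  rcases (Finset.univ.filter fun j => s j ≤ t ∧ t < s j + x j).eq_empty_or_nonempty with he | hne
  · simp [he]
  set A := Finset.univ.filter fun j => s j ≤ t ∧ t < s j + x j
  -- the last active thread started when fewer than `L` threads before it were in progress
  obtain ⟨m, hmA, hm⟩ : ∃ m ∈ A, ∀ j ∈ A, j ≤ m :=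
    ⟨A.max' hne, A.max'_mem hne, fun j hj => A.le_max' j hj⟩
  have hms : s m ≤ t ∧ t < s m + x m := by simpa [A] using hmA
  have h1 := h.card_lt m (ne_top_of_le_ne_top ht hms.1)
  have h2 := numLE_mono (fun j' => if j' < m then s j' + x j' else ⊤) hms.1
  have h3 : A.card + numLE (fun j' => if j' < m then s j' + x j' else ⊤) t ≤ m + 1 := by
    rw [numLE, ← Finset.card_union_of_disjoint, ← Fin.card_Iic]
    · refine Finset.card_le_card fun j hj => ?_
      rw [Finset.mem_Iic]
      rcases Finset.mem_union.1 hj with hj | hj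
      · exact hm j hj
      · by_contra hlt
        have : ¬ j < m := fun h' => hlt h'.le
        simp [this, ht] at hj
    · refine Finset.disjoint_left.2 fun j hj hj' => ?_
      simp only [A, Finset.mem_filter, Finset.mem_univ, true_and] at hj hj'
      split_ifs at hj'
      · exact absurd hj.2 (not_lt.2 hj')
      · exact ht (top_le_iff.1 hj')
  omega

lemma le_card_active (h : IsGreedyStart L k b x s) (hk : 1 ≤ k) (hn : L + k - 1 ≤ n) {t : ℝ≥0∞}
    (ht : t ≠ ⊤) (hb : b ≤ t) (hd : t < orderStat k fun j => s j + x j) :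
    L ≤ (Finset.univ.filter fun j => s j ≤ t ∧ t < s j + x j).card := by
  rw [lt_orderStat_iff ht] at hd
  set c := numLE (fun j => s j + x j) t with hc
  have hstart : ∀ j : Fin n, (j : ℕ) < L + c → s j ≤ t := by
    intro j hj
    by_cases hex : ∃ j', j ≤ j' ∧ s j' + x j' ≤ t
    · obtain ⟨j', hjj', hj'⟩ := hex
      exact (h.mono hjj').trans (le_self_add.trans hj')
    · push Not at hex
      have : numLE (fun j' => if j' < j then s j' + x j' else ⊤) t = c := by
        refine numLE_congr fun j' => ?_
        by_cases hlt : j' < j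
        · simp [hlt]
        · simpa [hlt, ht] using hex j' (not_lt.1 hlt)
      exact h.le_of j t ht hb (by omega) (by omega)
  have h1 : (Finset.univ.filter fun j : Fin n => (j : ℕ) < L + c).card = L + c := by
    rw [Fin.card_filter_val_lt]
    omega
  have h2 : (Finset.univ.filter fun j : Fin n => (j : ℕ) < L + c).card ≤
      (Finset.univ.filter fun j => s j ≤ t ∧ t < s j + x j).card + c := by
    rw [hc, numLE]
    refine le_trans (Finset.card_le_card fun j hj => ?_) (Finset.card_union_le _ _)
    simp only [Finset.mem_filter, Finset.mem_univ, true_and, Finset.mem_union] at hj ⊢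
    by_cases hj' : s j + x j ≤ t
    · exact Or.inr hj'
    · exact Or.inl ⟨hstart j hj, not_le.1 hj'⟩
  omega

end IsGreedyStart

end SingleRequest

/-! ### The greedy scheme -/

section GreedyScheme

variable {n : ℕ} {U : Type*}

/-- The time at which the greedy scheme turns to request `i`: the request has arrived, and the
requests before it have departed. -/
noncomputable def greedyBegin (L k : ℕ) (ω : Sample n U) : ℕ → ℝ≥0∞
  | 0 => ω.arr 0
  | i + 1 => (ω.arr (i + 1) : ℝ≥0∞) ⊔ orderStat k fun j =>
      greedyStart L k (greedyBegin L k ω i) (fun j => ENNReal.ofReal (ω.dl (i, j))) j +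
        ENNReal.ofReal (ω.dl (i, j))

/-- The starting times of the greedy scheme, which serves the requests one after the other. -/
noncomputable def greedyRule (L k : ℕ) : StartRule n U := fun ω p =>
  greedyStart L k (greedyBegin L k ω p.1) (fun j => ENNReal.ofReal (ω.dl (p.1, j))) p.2

variable {L k : ℕ} {ω ω' : Sample n U}

lemma greedyBegin_succ (i : ℕ) : greedyBegin L k ω (i + 1) =
    (ω.arr (i + 1) : ℝ≥0∞) ⊔ (greedyRule L k : StartRule n U).departure k ω i := rfl

lemma isGreedyStart_greedyRule (ω : Sample n U) (i : ℕ) :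
    IsGreedyStart L k (greedyBegin L k ω i) (fun j => ENNReal.ofReal (ω.dl (i, j)))
      fun j => greedyRule L k ω (i, j) :=
  isGreedyStart_greedyStart L k _ _

lemma Sample.Regular.ofReal_pos (h : ω.Regular) (p : ℕ × Fin n) : 0 < ENNReal.ofReal (ω.dl p) :=
  ENNReal.ofReal_pos.2 (h.2 p)

lemma arr_le_greedyBegin (ω : Sample n U) (i : ℕ) : (ω.arr i : ℝ≥0∞) ≤ greedyBegin L k ω i := by
  cases i with
  | zero => exact le_rfl
  | succ i => exact le_sup_left

lemma greedyRule_lt_departure (h : ω.Regular) {p : ℕ × Fin n}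
    (hp : greedyRule L k ω p ≠ ⊤) :
    greedyRule L k ω p < (greedyRule L k : StartRule n U).departure k ω p.1 :=
  (isGreedyStart_greedyRule ω p.1).lt_orderStat (fun j => h.ofReal_pos (p.1, j)) (j := p.2) hp

lemma greedyBegin_le_departure (hk : 1 ≤ k) (ω : Sample n U) (i : ℕ) :
    greedyBegin L k ω i ≤ (greedyRule L k : StartRule n U).departure k ω i := by
  by_contra! hlt
  have hne := hlt.ne_top
  have h1 := (StartRule.departure_le_iff hne).1
    (le_refl ((greedyRule L k : StartRule n U).departure k ω i))
  have : 0 < numLE (fun j => (greedyRule L k : StartRule n U).finish ω (i, j))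
    ((greedyRule L k : StartRule n U).departure k ω i) := by omega
  obtain ⟨j, hj⟩ := Finset.card_pos.1 this
  simp only [Finset.mem_filter, Finset.mem_univ, true_and] at hj
  exact absurd (((isGreedyStart_greedyRule ω i).begin_le j).trans (le_self_add.trans hj))
    (not_le.2 hlt)

lemma departure_le_greedyBegin (hk : 1 ≤ k) (ω : Sample n U) {i i' : ℕ} (h : i < i') :
    (greedyRule L k : StartRule n U).departure k ω i ≤ greedyBegin L k ω i' := by
  induction i', h using Nat.le_induction with
  | base => exact le_sup_right
  | succ m _ ih => exact (ih.trans (greedyBegin_le_departure hk ω m)).trans le_sup_right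

/-- The greedy scheme serves one request at a time. -/
lemma eq_of_greedyRule_active (hk : 1 ≤ k) {t : ℝ≥0} {p q : ℕ × Fin n}
    (hp : (greedyRule L k).Active k ω t p) (hq : (greedyRule L k).Active k ω t q) :
    p.1 = q.1 := by
  have key : ∀ {p q : ℕ × Fin n}, (greedyRule L k).Active k ω t p →
      (greedyRule L k).Active k ω t q → ¬ p.1 < q.1 := fun {p q} hp hq h =>
    absurd (((departure_le_greedyBegin hk ω h).trans
      ((isGreedyStart_greedyRule ω q.1).begin_le q.2)).trans hq.1) (not_le.2 hp.2.2)
  exact le_antisymm (not_lt.1 (key hq hp)) (not_lt.1 (key hp hq))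

lemma greedyRule_card_active_le (ω : Sample n U) (t : ℝ≥0) (i : ℕ) :
    {j | (greedyRule L k).Active k ω t (i, j)}.encard ≤ L := by
  refine le_trans (Set.encard_le_encard (t := ((Finset.univ.filter fun j : Fin n =>
    greedyRule L k ω (i, j) ≤ t ∧
      (t : ℝ≥0∞) < greedyRule L k ω (i, j) + ENNReal.ofReal (ω.dl (i, j)) : Finset (Fin n)) :
      Set (Fin n))) fun j hj => ?_) ?_
  · simpa using ⟨hj.1, hj.2.1⟩
  · rw [Set.encard_coe_eq_coe_finsetCard]
    exact_mod_cast (isGreedyStart_greedyRule ω i).card_active_le ENNReal.coe_ne_top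

/-- Whether a request has departed can be read off from the successful downloads. -/
lemma StartRule.departure_le_iff_observed {S : StartRule n U} {t : ℝ≥0∞} (ht : t ≠ ⊤) (i : ℕ) :
    S.departure k ω i ≤ t ↔ k ≤ numLE (fun j => S.observed k ω (i, j)) t := by
  constructor
  · intro h
    have hd := ne_top_of_le_ne_top ht h
    refine ((departure_le_iff hd).1 le_rfl).trans (le_trans ?_ (numLE_mono _ h))
    refine Finset.card_le_card fun j => ?_
    simp only [Finset.mem_filter, Finset.mem_univ, true_and]
    intro hj
    rwa [observed, if_pos hj]
  · intro h
    rw [departure_le_iff ht]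
    refine h.trans (numLE_anti (fun j => ?_) t)
    unfold observed
    split_ifs <;> simp

lemma StartRule.finish_le_iff_observed {S : StartRule n U} {t : ℝ≥0∞} {p : ℕ × Fin n}
    (ht : t ≠ ⊤) (h : t < S.departure k ω p.1) :
    S.finish ω p ≤ t ↔ S.observed k ω p ≤ t := by
  unfold observed
  split_ifs with h'
  · rfl
  · exact ⟨fun h'' => absurd (h''.trans h.le) h', fun h'' => absurd (top_le_iff.1 h'') ht⟩

lemma AgreeUpTo.le_iff {ι : Type*} {t : ℝ≥0} {f g : ι → ℝ≥0∞} (h : AgreeUpTo t f g) (i : ι)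
    {s : ℝ≥0∞} (hs : s ≤ t) : f i ≤ s ↔ g i ≤ s :=
  ⟨fun h' => (h i (Or.inl (h'.trans hs))) ▸ h', fun h' => (h i (Or.inr (h'.trans hs))) ▸ h'⟩

/-- The decisions of the greedy scheme up to time `t` are determined by the arrivals and the
successful downloads up to time `t`: the latter determine which requests have departed, and, as
long as a request has not departed, which of its threads have finished. -/
lemma greedyRule_nonanticipative (h : ω.Regular) (h' : ω'.Regular) (t : ℝ≥0)
    (harr : AgreeUpTo t (fun i => (ω.arr i : ℝ≥0∞)) (fun i => (ω'.arr i : ℝ≥0∞)))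
    (hobs : AgreeUpTo t ((greedyRule L k).observed k ω) ((greedyRule L k).observed k ω')) :
    AgreeUpTo t (greedyRule L k ω) (greedyRule L k ω') := by
  have hdep : ∀ i, ∀ s ≤ (t : ℝ≥0∞), (greedyRule L k).departure k ω i ≤ s ↔
      (greedyRule L k).departure k ω' i ≤ s := by
    intro i s hs
    have hst := ne_top_of_le_ne_top ENNReal.coe_ne_top hs
    rw [StartRule.departure_le_iff_observed hst, StartRule.departure_le_iff_observed hst,
      numLE_congr fun j => hobs.le_iff (i, j) hs]
  have hbegin : ∀ i, ∀ s ≤ (t : ℝ≥0∞), greedyBegin L k ω i ≤ s ↔ greedyBegin L k ω' i ≤ s := by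
    intro i s hs
    cases i with
    | zero => exact harr.le_iff 0 hs
    | succ i =>
      rw [greedyBegin_succ, greedyBegin_succ, sup_le_iff, sup_le_iff, hdep i s hs,
        harr.le_iff (i + 1) hs]
  have key : ∀ {ω ω' : Sample n U}, ω.Regular →
      AgreeUpTo t ((greedyRule L k).observed k ω) ((greedyRule L k).observed k ω') →
      (∀ i, ∀ s ≤ (t : ℝ≥0∞), (greedyRule L k).departure k ω i ≤ s ↔
        (greedyRule L k).departure k ω' i ≤ s) →
      (∀ i, ∀ s ≤ (t : ℝ≥0∞), greedyBegin L k ω i ≤ s ↔ greedyBegin L k ω' i ≤ s) →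
      ∀ p, greedyRule L k ω p ≤ t → greedyRule L k ω' p ≤ greedyRule L k ω p := by
    intro ω ω' h hobs hdep hbegin p hp
    obtain ⟨i, j⟩ := p
    set s := greedyRule L k ω (i, j) with hs
    have hst : s ≠ ⊤ := ne_top_of_le_ne_top ENNReal.coe_ne_top hp
    have hd : s < (greedyRule L k).departure k ω i := greedyRule_lt_departure h hst
    have hd' : s < (greedyRule L k).departure k ω' i := by
      rw [← not_le] at hd ⊢
      rwa [← hdep i s hp]
    have hg := isGreedyStart_greedyRule (L := L) (k := k) ω i
    have hg' := isGreedyStart_greedyRule (L := L) (k := k) ω' i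
    have hcount : numLE (fun j' => if j' < j then greedyRule L k ω (i, j') +
          ENNReal.ofReal (ω.dl (i, j')) else ⊤) s =
        numLE (fun j' => if j' < j then greedyRule L k ω' (i, j') +
          ENNReal.ofReal (ω'.dl (i, j')) else ⊤) s := by
      refine numLE_congr fun j' => ?_
      split_ifs
      · exact ((StartRule.finish_le_iff_observed (p := (i, j')) hst hd).trans
          (hobs.le_iff _ hp)).trans (StartRule.finish_le_iff_observed (p := (i, j')) hst hd').symm
      · rfl
    refine hg'.le_of j s hst ((hbegin i s hp).1 (hg.begin_le j)) ?_ ?_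
    · rw [← hcount]
      exact hg.card_lt j hst
    · rw [← hcount]
      exact hg.card_lt_k j hst
  have hobs' : AgreeUpTo t ((greedyRule L k).observed k ω') ((greedyRule L k).observed k ω) :=
    fun p hp => (hobs p hp.symm).symm
  have key1 := key h hobs hdep hbegin
  have key2 := key h' hobs' (fun i s hs => (hdep i s hs).symm) fun i s hs => (hbegin i s hs).symm
  rintro p (hp | hp)
  · exact le_antisymm (key2 p ((key1 p hp).trans hp)) (key1 p hp)
  · exact le_antisymm (key2 p hp) (key1 p ((key2 p hp).trans hp))

variable [MeasurableSpace U]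

lemma Sample.measurable_toTriple : Measurable (Sample.toTriple (n := n) (U := U)) :=
  comap_measurable _

lemma Sample.measurable_arr (i : ℕ) : Measurable fun ω : Sample n U => ω.arr i :=
  (measurable_pi_apply i).comp (measurable_fst.comp Sample.measurable_toTriple)

lemma Sample.measurable_dl (p : ℕ × Fin n) : Measurable fun ω : Sample n U => ω.dl p :=
  (measurable_pi_apply p).comp
    (measurable_fst.comp (measurable_snd.comp Sample.measurable_toTriple))

lemma measurable_greedyBegin (i : ℕ) :
    Measurable fun ω : Sample n U => greedyBegin L k ω i := by
  induction i with
  | zero => exact (Sample.measurable_arr 0).coe_nnreal_ennreal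
  | succ i ih =>
    exact (Sample.measurable_arr (i + 1)).coe_nnreal_ennreal.sup (measurable_orderStat k fun j =>
      (measurable_greedyStart L k ih (fun j => (Sample.measurable_dl (i, j)).ennreal_ofReal) j).add
        (Sample.measurable_dl (i, j)).ennreal_ofReal)

/-- The greedy scheme as an on-line scheme. -/
noncomputable def greedyScheme (L n k : ℕ) (U : Type*) [MeasurableSpace U] (hk : 1 ≤ k) :
    OnlineScheme L n k U where
  start := greedyRule L k
  measurable_start p := measurable_greedyStart L k (measurable_greedyBegin p.1)
    (fun j => (Sample.measurable_dl (p.1, j)).ennreal_ofReal) p.2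
  arr_le_start ω _ i j :=
    (arr_le_greedyBegin ω i).trans ((isGreedyStart_greedyRule ω i).begin_le j)
  start_mono ω _ i := (isGreedyStart_greedyRule ω i).mono
  start_lt_departure ω h i j hlt := greedyRule_lt_departure h (p := (i, j)) hlt.ne
  card_active_le ω h t := by
    rcases Set.eq_empty_or_nonempty {p | (greedyRule L k).Active k ω t p} with he | ⟨q, hq⟩
    · simp [he]
    · refine le_trans (le_trans (Set.encard_le_encard (t := Prod.mk q.1 ''
        {j | (greedyRule L k).Active k ω t (q.1, j)}) fun p hp => ?_) (Set.encard_image_le _ _))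
        (greedyRule_card_active_le ω t q.1)
      obtain ⟨i, j⟩ := p
      obtain rfl : i = q.1 := eq_of_greedyRule_active hk hp hq
      exact ⟨j, hp, rfl⟩
  nonanticipative ω ω' h h' _ t harr hobs := greedyRule_nonanticipative h h' t harr hobs

lemma isGreedy_greedyScheme (hk : 1 ≤ k) (hn : L + k - 1 ≤ n) :
    (greedyScheme L n k U hk).IsGreedy := by
  intro ω h t i hi
  have hbegin : greedyBegin L k ω i ≤ t := by
    cases i with
    | zero => exact ENNReal.coe_le_coe.2 hi.1
    | succ i => exact sup_le (by exact_mod_cast hi.1) (hi.2.2 i i.lt_succ_self)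
  have hcard : (L : ℕ∞) ≤ {j | (greedyRule L k).Active k ω t (i, j)}.encard := by
    have := (isGreedyStart_greedyRule (L := L) (k := k) ω i).le_card_active hk hn
      ENNReal.coe_ne_top hbegin hi.2.1
    refine le_trans (Nat.cast_le.2 this) ?_
    rw [← Set.encard_coe_eq_coe_finsetCard]
    refine Set.encard_le_encard fun j hj => ?_
    simp only [Finset.coe_filter, Finset.mem_univ, true_and] at hj
    exact ⟨hj.1, hj.2, hi.2.1⟩
  refine ⟨le_antisymm (greedyRule_card_active_le ω t i) hcard, fun i' j hne hact => ?_⟩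
  -- request `i'` has departed if `i' < i`, and its service begins after `i` departs if `i < i'`
  rcases lt_or_gt_of_ne hne with hlt | hgt
  · exact absurd (hi.2.2 i' hlt) (not_le.2 hact.2.2)
  · exact absurd (((departure_le_greedyBegin hk ω hgt).trans
      ((isGreedyStart_greedyRule ω i').begin_le j)).trans hact.1) (not_le.2 hi.2.1)

end GreedyScheme

/-! ### Causality: the dispatcher does not foresee downloading times -/

section Causal

variable {ι : Type*}

/-- The finishing times of threads with starting times `S d` and downloading times `d`. -/
noncomputable def finishTime (S : (ι → ℝ) → ι → ℝ≥0∞) (d : ι → ℝ) (p : ι) : ℝ≥0∞ :=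
  S d p + ENNReal.ofReal (d p)

/-- A rule for the starting times is causal if prolonging the download of a thread changes no
starting time before the moment at which this download would have finished. -/
def Causal (S : (ι → ℝ) → ι → ℝ≥0∞) : Prop :=
  ∀ (d d' : ι → ℝ) (p : ι), (∀ q, 0 < d q) → (∀ q, 0 < d' q) → (∀ q, q ≠ p → d q = d' q) →
    d p ≤ d' p → ∀ q, S d q < finishTime S d p ∨ S d' q < finishTime S d p → S d q = S d' q

lemma start_lt_finishTime {S : (ι → ℝ) → ι → ℝ≥0∞} {d : ι → ℝ} {p : ι} (hd : 0 < d p)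
    (h : S d p ≠ ⊤) : S d p < finishTime S d p :=
  ENNReal.lt_add_right h (ENNReal.ofReal_pos.2 hd).ne'

lemma start_lt_of_finishTime_le {S : (ι → ℝ) → ι → ℝ≥0∞} {d : ι → ℝ} {p : ι} {t : ℝ≥0∞}
    (hd : 0 < d p) (ht : t ≠ ⊤) (h : finishTime S d p ≤ t) : S d p < t :=
  (start_lt_finishTime hd (ne_top_of_le_ne_top ht (le_self_add.trans h))).trans_le h

variable {S : (ι → ℝ) → ι → ℝ≥0∞} {d d' : ι → ℝ} {p : ι}

lemma Causal.start_eq (hS : Causal S) (hd : ∀ q, 0 < d q) (hd' : ∀ q, 0 < d' q)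
    (hoff : ∀ q, q ≠ p → d q = d' q) (hle : d p ≤ d' p) : S d p = S d' p := by
  by_cases h : S d p = ⊤
  · by_contra hne
    refine hne (hS d d' p hd hd' hoff hle p (Or.inr ?_))
    simpa [finishTime, h, lt_top_iff_ne_top] using fun h' => hne (h.trans h'.symm)
  · exact hS d d' p hd hd' hoff hle p (Or.inl (start_lt_finishTime (hd p) h))

lemma Causal.finishTime_le_iff (hS : Causal S) (hd : ∀ q, 0 < d q) (hd' : ∀ q, 0 < d' q)
    (hoff : ∀ q, q ≠ p → d q = d' q) (hle : d p ≤ d' p) {q : ι} (hq : q ≠ p) {t : ℝ≥0∞}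
    (ht : t ≤ finishTime S d p) (ht' : t ≠ ⊤) : finishTime S d q ≤ t ↔ finishTime S d' q ≤ t := by
  constructor
  · intro h
    have := hS d d' p hd hd' hoff hle q
      (Or.inl ((start_lt_of_finishTime_le (hd q) ht' h).trans_le ht))
    rwa [finishTime, ← this, ← hoff q hq]
  · intro h
    have := hS d d' p hd hd' hoff hle q
      (Or.inr ((start_lt_of_finishTime_le (hd' q) ht' h).trans_le ht))
    rwa [finishTime, this, hoff q hq]

lemma Causal.finishTime_eq_iff (hS : Causal S) (hd : ∀ q, 0 < d q) (hd' : ∀ q, 0 < d' q)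
    (hoff : ∀ q, q ≠ p → d q = d' q) (hle : d p ≤ d' p) {q : ι} (hq : q ≠ p) {t : ℝ≥0∞}
    (ht : t ≤ finishTime S d p) (ht' : t ≠ ⊤) : finishTime S d q = t ↔ finishTime S d' q = t := by
  have key : ∀ s ≤ t, finishTime S d q ≤ s ↔ finishTime S d' q ≤ s := fun s hs =>
    hS.finishTime_le_iff hd hd' hoff hle hq (hs.trans ht) (ne_top_of_le_ne_top ht' hs)
  constructor
  · intro h
    have h' := (key t le_rfl).1 h.le
    exact le_antisymm h' (h ▸ (key _ h').2 le_rfl)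
  · intro h
    have h' := (key t le_rfl).2 h.le
    exact le_antisymm h' (h ▸ (key _ h').1 le_rfl)

end Causal

lemma Sample.IsArrivalPath.finite_setOf_le {a : ℕ → ℝ≥0} (ha : Sample.IsArrivalPath a) (t : ℝ≥0) :
    {i | a i ≤ t}.Finite := by
  obtain ⟨N, hN⟩ := eventually_atTop.1 (ha.2.eventually_gt_atTop t)
  exact (Set.finite_lt_nat N).subset fun i hi => not_le.1 fun h => not_lt.2 hi (hN i h)

namespace StartRule

variable {n k : ℕ} {U : Type*} {S : StartRule n U}

/-- If the threads which finish by time `t` finish at the same times in two samples, then the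
successful downloads up to time `t` are the same. -/
lemma agreeUpTo_observed {ω ω' : Sample n U} {t : ℝ≥0}
    (h : AgreeUpTo t (S.finish ω) (S.finish ω')) :
    AgreeUpTo t (S.observed k ω) (S.observed k ω') := by
  have key : ∀ {ω ω' : Sample n U}, AgreeUpTo t (S.finish ω) (S.finish ω') → ∀ p,
      S.observed k ω p ≤ t → S.observed k ω p = S.observed k ω' p := by
    intro ω ω' h p hp
    by_cases hobs : S.finish ω p ≤ S.departure k ω p.1
    · rw [observed, if_pos hobs] at hp ⊢
      have heq := h p (Or.inl hp)
      rw [observed, if_pos, heq]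
      by_contra! hlt
      rw [← heq] at hlt
      have hst : S.departure k ω' p.1 ≤ (t : ℝ≥0∞) := hlt.le.trans hp
      have hle : S.departure k ω p.1 ≤ S.departure k ω' p.1 := by
        rw [departure_le_iff hlt.ne_top, numLE_congr fun j => h.le_iff (p.1, j) hst]
        exact (departure_le_iff hlt.ne_top).1 le_rfl
      exact absurd (hobs.trans hle) (not_le.2 hlt)
    · rw [observed, if_neg hobs] at hp
      exact absurd (top_le_iff.1 hp) ENNReal.coe_ne_top
  rintro p (hp | hp)
  · exact key h p hp
  · exact (key (fun q hq => (h q hq.symm).symm) p hp).symm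

end StartRule

/-- On-line schemes are causal: at the least time at which the starting times in the two samples
disagree, the dispatcher would have seen the same arrivals and successful downloads. -/
lemma OnlineScheme.causal {L n k : ℕ} {U : Type*} [MeasurableSpace U] (σ : OnlineScheme L n k U)
    {a : ℕ → ℝ≥0} (ha : Sample.IsArrivalPath a) (u : U) :
    Causal fun d => σ.start ⟨a, d, u⟩ := by
  intro d d' p hd hd' hoff hle q₀ hq₀
  set S : (ℕ × Fin n → ℝ) → ℕ × Fin n → ℝ≥0∞ := fun d => σ.start ⟨a, d, u⟩ with hS
  change S d q₀ = S d' q₀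
  by_contra hne
  set m : ℕ × Fin n → ℝ≥0∞ := fun q => min (S d q) (S d' q) with hm
  have hmlt : m q₀ < finishTime S d p := min_lt_iff.2 hq₀
  have hreg : Sample.Regular (⟨a, d, u⟩ : Sample n U) := ⟨ha, hd⟩
  have hreg' : Sample.Regular (⟨a, d', u⟩ : Sample n U) := ⟨ha, hd'⟩
  have hfin : {q | S d q ≠ S d' q ∧ m q ≤ m q₀}.Finite := by
    obtain ⟨t, ht⟩ : ∃ t : ℝ≥0, (t : ℝ≥0∞) = m q₀ := ⟨_, ENNReal.coe_toNNReal hmlt.ne_top⟩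
    refine ((ha.finite_setOf_le t).prod (Set.finite_univ (α := Fin n))).subset fun q hq => ?_
    refine ⟨?_, Set.mem_univ _⟩
    have h1 : (a q.1 : ℝ≥0∞) ≤ m q :=
      le_min (σ.arr_le_start _ hreg q.1 q.2) (σ.arr_le_start _ hreg' q.1 q.2)
    have h2 := h1.trans hq.2
    rw [← ht] at h2
    exact ENNReal.coe_le_coe.1 h2
  obtain ⟨q₁, ⟨hq₁, hq₁le⟩, hmin⟩ := hfin.exists_minimalFor m _ ⟨q₀, hne, le_rfl⟩
  have hlt : m q₁ < finishTime S d p := hq₁le.trans_lt hmlt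
  obtain ⟨t, ht⟩ : ∃ t : ℝ≥0, (t : ℝ≥0∞) = m q₁ := ⟨_, ENNReal.coe_toNNReal hlt.ne_top⟩
  have hbefore : ∀ q, m q < t → S d q = S d' q := by
    intro q hq
    by_contra h
    rw [ht] at hq
    exact absurd (hmin ⟨h, hq.le.trans hq₁le⟩ hq.le) (not_le.2 hq)
  have hagree : AgreeUpTo t (σ.start.finish ⟨a, d, u⟩) (σ.start.finish ⟨a, d', u⟩) := by
    change AgreeUpTo t (finishTime S d) (finishTime S d')
    rintro q (hq | hq)
    · have hs := hbefore q (min_lt_of_left_lt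
        (start_lt_of_finishTime_le (hd q) ENNReal.coe_ne_top hq))
      rcases eq_or_ne q p with rfl | hqp
      · exact absurd hq (not_le.2 (ht ▸ hlt))
      · rw [finishTime, finishTime, hs, hoff q hqp]
    · have hs := hbefore q (min_lt_of_right_lt
        (start_lt_of_finishTime_le (hd' q) ENNReal.coe_ne_top hq))
      rcases eq_or_ne q p with rfl | hqp
      · have : finishTime S d q ≤ finishTime S d' q := by
          rw [finishTime, finishTime, hs]
          gcongr
        exact absurd (this.trans hq) (not_le.2 (ht ▸ hlt))
      · rw [finishTime, finishTime, hs, hoff q hqp]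
  refine hq₁ (σ.nonanticipative ⟨a, d, u⟩ ⟨a, d', u⟩ hreg hreg' rfl t (fun _ _ => rfl)
    (StartRule.agreeUpTo_observed hagree) q₁ ?_)
  rw [ht]
  exact min_le_iff.1 le_rfl

/-! ### The intensity of the completions -/

section Intensity

/-- An exponential time `X` of rate `μ` has the compensator `μ (X ∧ ·)`. -/
lemma lintegral_expMeasure {μ : ℝ} (hμ : 0 < μ) {h : ℝ → ℝ≥0∞} (hh : Measurable h) :
    ∫⁻ x, h x ∂(expMeasure μ) =
      ∫⁻ x, (ENNReal.ofReal μ * ∫⁻ y in Set.Ico 0 x, h y) ∂(expMeasure μ) := by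
  have : IsProbabilityMeasure (expMeasure μ) := isProbabilityMeasure_expMeasure hμ
  have hdens : expMeasure μ = volume.withDensity (exponentialPDF μ) := rfl
  have hpdf : Measurable (exponentialPDF μ) :=
    (measurable_exponentialPDFReal μ).ennreal_ofReal
  have htail : ∀ y, 0 ≤ y → ENNReal.ofReal μ * expMeasure μ (Set.Ioi y) = exponentialPDF μ y := by
    intro y hy
    rw [← Set.compl_Iic, prob_compl_eq_one_sub measurableSet_Iic, hdens,
      withDensity_apply _ measurableSet_Iic, lintegral_exponentialPDF_eq_antiDeriv hμ, if_pos hy,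
      exponentialPDF_of_nonneg hy, ← ENNReal.ofReal_one, ← ENNReal.ofReal_sub,
      ← ENNReal.ofReal_mul hμ.le]
    · ring_nf
    · simpa using mul_nonneg hμ.le hy
  have hmeas : Measurable (Function.uncurry fun x y : ℝ =>
      (Set.Ico 0 x).indicator h y) := by
    have : (Function.uncurry fun x y : ℝ => (Set.Ico 0 x).indicator h y) =
        {z : ℝ × ℝ | 0 ≤ z.2 ∧ z.2 < z.1}.indicator fun z => h z.2 := by
      ext z
      simp [Function.uncurry, Set.indicator_apply]
    rw [this]
    exact (hh.comp measurable_snd).indicator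
      ((measurableSet_le measurable_const measurable_snd).inter
        (measurableSet_lt measurable_snd measurable_fst))
  calc ∫⁻ x, h x ∂(expMeasure μ) = ∫⁻ y, exponentialPDF μ y * h y := by
        rw [hdens, lintegral_withDensity_eq_lintegral_mul _ hpdf hh]
        rfl
    _ = ∫⁻ y, ENNReal.ofReal μ * ∫⁻ x, (Set.Ico 0 x).indicator h y ∂(expMeasure μ) := by
        refine lintegral_congr fun y => ?_
        by_cases hy : 0 ≤ y
        · rw [← htail y hy]
          have : ∀ x, (Set.Ico 0 x).indicator h y = (Set.Ioi y).indicator (fun _ => h y) x := by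
            intro x
            simp [Set.indicator_apply, hy]
          simp only [this]
          rw [lintegral_indicator measurableSet_Ioi, lintegral_const, Measure.restrict_apply_univ]
          ring
        · have : ∀ x, (Set.Ico 0 x).indicator h y = 0 := by
            intro x
            simp [hy]
          simp [this, exponentialPDF_of_neg (not_le.1 hy)]
    _ = ENNReal.ofReal μ * ∫⁻ x, ∫⁻ y, (Set.Ico 0 x).indicator h y ∂volume ∂(expMeasure μ) := by
        rw [lintegral_const_mul' _ _ ENNReal.ofReal_ne_top, lintegral_lintegral_swap]
        exact (hmeas.comp measurable_swap).aemeasurable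
    _ = _ := by
        rw [lintegral_const_mul' _ _ ENNReal.ofReal_ne_top]
        simp only [lintegral_indicator measurableSet_Ico]

lemma ae_pos_expMeasure {μ : ℝ} : ∀ᵐ x ∂(expMeasure μ), 0 < x := by
  have hdens : expMeasure μ = volume.withDensity (exponentialPDF μ) := rfl
  have : expMeasure μ (Set.Iic 0) = 0 := by
    rw [hdens, withDensity_apply _ measurableSet_Iic, setLIntegral_congr Iio_ae_eq_Iic.symm,
      lintegral_exponentialPDF_of_nonpos le_rfl]
  rw [ae_iff]
  simpa [Set.Iic] using this

lemma ae_pos_infinitePi {ι : Type*} [Countable ι] {μ : ℝ} (hμ : 0 < μ) :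
    ∀ᵐ d ∂(Measure.infinitePi fun _ : ι => expMeasure μ), ∀ p, 0 < d p := by
  have : IsProbabilityMeasure (expMeasure μ) := isProbabilityMeasure_expMeasure hμ
  rw [ae_all_iff]
  exact fun p => (measurePreserving_eval_infinitePi (fun _ : ι => expMeasure μ)
    p).quasiMeasurePreserving.ae ae_pos_expMeasure

lemma measurable_finishTime {ι : Type*} {S : (ι → ℝ) → ι → ℝ≥0∞}
    (hSm : ∀ q, Measurable fun d => S d q) (q : ι) : Measurable fun d => finishTime S d q :=
  (hSm q).add (measurable_pi_apply q).ennreal_ofReal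

lemma measurable_mark_finish {α : Type*} [MeasurableSpace α] {H : α → ℝ≥0∞ → ℝ≥0∞}
    (hH : Measurable (Function.uncurry H)) {F : α → ℝ≥0∞} (hF : Measurable F) (s t : ℝ) :
    Measurable fun d =>
      if ENNReal.ofReal s < F d ∧ F d ≤ ENNReal.ofReal t then H d (F d) else 0 :=
  Measurable.ite ((measurableSet_lt measurable_const hF).inter
    (measurableSet_le hF measurable_const)) (hH.comp (measurable_id.prodMk hF)) measurable_const

lemma measurable_mark_active {α : Type*} [MeasurableSpace α] {H : α → ℝ≥0∞ → ℝ≥0∞}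
    (hH : Measurable (Function.uncurry H)) {S F : α → ℝ≥0∞} (hS : Measurable S)
    (hF : Measurable F) : Measurable fun z : α × ℝ =>
      if S z.1 ≤ ENNReal.ofReal z.2 ∧ ENNReal.ofReal z.2 < F z.1
        then H z.1 (ENNReal.ofReal z.2) else 0 :=
  Measurable.ite ((measurableSet_le (hS.comp measurable_fst)
    measurable_snd.ennreal_ofReal).inter (measurableSet_lt measurable_snd.ennreal_ofReal
    (hF.comp measurable_fst)))
    (hH.comp (measurable_fst.prodMk measurable_snd.ennreal_ofReal)) measurable_const

variable {ι : Type*} [DecidableEq ι]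

lemma measurable_update_prod (p : ι) :
    Measurable fun z : (ι → ℝ) × ℝ => Function.update z.1 p z.2 := by
  refine measurable_pi_iff.2 fun q => ?_
  rcases eq_or_ne q p with rfl | h
  · simpa using measurable_snd
  · simp only [Function.update_of_ne h]
    exact (measurable_pi_apply q).comp measurable_fst

/-- Resampling one coordinate of an i.i.d. family does not change its law. -/
lemma map_update_infinitePi (ρ : Measure ℝ) [IsProbabilityMeasure ρ] (p : ι) :
    ((Measure.infinitePi fun _ : ι => ρ).prod ρ).map (fun z => Function.update z.1 p z.2) =
      Measure.infinitePi fun _ : ι => ρ := by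
  have hm := measurable_update_prod p
  refine Measure.eq_infinitePi _ fun s t ht => ?_
  rw [Measure.map_apply hm (MeasurableSet.pi s.countable_toSet fun i _ => ht i)]
  by_cases hp : p ∈ s
  · have : (fun z : (ι → ℝ) × ℝ => Function.update z.1 p z.2) ⁻¹' (Set.pi s t) =
        (Set.pi (s.erase p) t) ×ˢ t p := by
      ext z
      simp only [Set.mem_preimage, Set.mem_pi, Set.mem_prod, Finset.coe_erase, Set.mem_sdiff,
        Set.mem_singleton_iff, Finset.mem_coe]
      constructor
      · intro h
        exact ⟨fun i hi => by simpa [Function.update_of_ne hi.2] using h i hi.1,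
          by simpa using h p hp⟩
      · rintro ⟨h1, h2⟩ i hi
        rcases eq_or_ne i p with rfl | hne
        · simpa using h2
        · simpa [Function.update_of_ne hne] using h1 i ⟨hi, hne⟩
    rw [this, Measure.prod_prod, Measure.infinitePi_pi _ fun i _ => ht i,
      Finset.prod_erase_mul _ _ hp]
  · have : (fun z : (ι → ℝ) × ℝ => Function.update z.1 p z.2) ⁻¹' (Set.pi s t) =
        (Set.pi s t) ×ˢ Set.univ := by
      ext z
      simp only [Set.mem_preimage, Set.mem_pi, Set.mem_prod, Finset.mem_coe, Set.mem_univ,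
        and_true]
      refine forall₂_congr fun i hi => ?_
      rw [Function.update_of_ne (ne_of_mem_of_not_mem hi hp)]
    rw [this, Measure.prod_prod, Measure.infinitePi_pi _ fun i _ => ht i, measure_univ, mul_one]

lemma lintegral_infinitePi_update (ρ : Measure ℝ) [IsProbabilityMeasure ρ] (p : ι)
    {f : (ι → ℝ) → ℝ≥0∞} (hf : Measurable f) :
    ∫⁻ d, f d ∂(Measure.infinitePi fun _ : ι => ρ) =
      ∫⁻ d, ∫⁻ x, f (Function.update d p x) ∂ρ ∂(Measure.infinitePi fun _ : ι => ρ) := by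
  have hm := measurable_update_prod p
  conv_lhs => rw [← map_update_infinitePi ρ p, lintegral_map hf hm]
  exact lintegral_prod _ (hf.comp hm).aemeasurable

/-- The intensity of the completion of the thread `p` is `μ` as long as the thread is in progress,
and `0` otherwise; the mark `H d t` may depend on everything except on how much longer than `t`
the thread `p` takes. -/
lemma lintegral_completion [Countable ι] {μ : ℝ} (hμ : 0 < μ) {S : (ι → ℝ) → ι → ℝ≥0∞}
    (hS : Causal S) (hSm : ∀ q, Measurable fun d => S d q) (p : ι)
    {H : (ι → ℝ) → ℝ≥0∞ → ℝ≥0∞} (hHm : Measurable (Function.uncurry H))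
    (hH : ∀ d d' : ι → ℝ, (∀ q, 0 < d q) → (∀ q, 0 < d' q) → (∀ q, q ≠ p → d q = d' q) →
      d p ≤ d' p → ∀ t, t ≤ finishTime S d p → t ≠ ⊤ → H d t = H d' t)
    {s t : ℝ} (hs : 0 ≤ s) (hst : s ≤ t) :
    ∫⁻ d, (if ENNReal.ofReal s < finishTime S d p ∧ finishTime S d p ≤ ENNReal.ofReal t
        then H d (finishTime S d p) else 0) ∂(Measure.infinitePi fun _ : ι => expMeasure μ) =
      ∫⁻ d, (ENNReal.ofReal μ * ∫⁻ τ in Set.Ioc s t,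
        if S d p ≤ ENNReal.ofReal τ ∧ ENNReal.ofReal τ < finishTime S d p
        then H d (ENNReal.ofReal τ) else 0) ∂(Measure.infinitePi fun _ : ι => expMeasure μ) := by
  have : IsProbabilityMeasure (expMeasure μ) := isProbabilityMeasure_expMeasure hμ
  have hFm := measurable_finishTime hSm
  have hlhs := measurable_mark_finish hHm (hFm p) s t
  have hrhs : Measurable fun d : ι → ℝ => ENNReal.ofReal μ * ∫⁻ τ in Set.Ioc s t,
      if S d p ≤ ENNReal.ofReal τ ∧ ENNReal.ofReal τ < finishTime S d p
        then H d (ENNReal.ofReal τ) else 0 :=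
    measurable_const.mul (measurable_mark_active hHm (hSm p) (hFm p)).lintegral_prod_right'
  refine (lintegral_infinitePi_update (expMeasure μ) p hlhs).trans
    ((lintegral_congr_ae ?_).trans (lintegral_infinitePi_update (expMeasure μ) p hrhs).symm)
  filter_upwards [ae_pos_infinitePi (ι := ι) hμ] with d hd
  have hpos : ∀ x : ℝ, 0 < x → ∀ q, 0 < Function.update d p x q := by
    intro x hx q
    rcases eq_or_ne q p with rfl | h
    · simpa using hx
    · simpa [Function.update_of_ne h] using hd q
  have hoff : ∀ x y : ℝ, ∀ q, q ≠ p → Function.update d p x q = Function.update d p y q := by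
    intro x y q h
    simp [Function.update_of_ne h]
  have hconst : ∀ x y : ℝ, 0 < x → 0 < y → x ≤ y →
      S (Function.update d p x) p = S (Function.update d p y) p := fun x y hx hy hxy =>
    hS.start_eq (hpos x hx) (hpos y hy) (hoff x y) (by simpa using hxy)
  -- the thread `p` starts at the same time `B`, however long it takes
  obtain ⟨B, hB⟩ : ∃ B, ∀ x, 0 < x → S (Function.update d p x) p = B := by
    refine ⟨S (Function.update d p 1) p, fun x hx => ?_⟩
    rcases le_total x 1 with h | h
    · exact hconst x 1 hx one_pos h
    · exact (hconst 1 x one_pos hx h).symm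
  have hF : ∀ x, 0 < x → finishTime S (Function.update d p x) p = B + ENNReal.ofReal x := by
    intro x hx
    rw [finishTime, hB x hx, Function.update_self]
  by_cases hBt : B = ⊤
  · trans 0
    · rw [← lintegral_zero (μ := expMeasure μ)]
      refine lintegral_congr_ae ?_
      filter_upwards [ae_pos_expMeasure (μ := μ)] with x hx
      simp [hF x hx, hBt]
    · symm
      rw [← lintegral_zero (μ := expMeasure μ)]
      refine lintegral_congr_ae ?_
      filter_upwards [ae_pos_expMeasure (μ := μ)] with x hx
      simp [hB x hx, hBt]
  obtain ⟨b, hb0, rfl⟩ : ∃ b : ℝ, 0 ≤ b ∧ ENNReal.ofReal b = B :=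
    ⟨B.toReal, ENNReal.toReal_nonneg, ENNReal.ofReal_toReal hBt⟩
  -- up to time `t`, the mark is that of a sample in which `p` has not finished by time `t`
  set r := Function.update d p (t + 1) with hr
  have ht1 : 0 < t + 1 := by linarith
  have hHr : ∀ x, 0 < x → ∀ τ, 0 ≤ τ → τ ≤ t → τ ≤ b + x →
      H (Function.update d p x) (ENNReal.ofReal τ) = H r (ENNReal.ofReal τ) := by
    intro x hx τ hτ0 hτt hτx
    rcases le_total x (t + 1) with h | h
    · refine hH _ _ (hpos x hx) (hpos _ ht1) (hoff _ _) (by simpa [hr] using h) _ ?_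
        ENNReal.ofReal_ne_top
      rw [hF x hx, ← ENNReal.ofReal_add hb0 hx.le]
      exact ENNReal.ofReal_le_ofReal hτx
    · refine (hH _ _ (hpos _ ht1) (hpos x hx) (hoff _ _) (by simpa [hr] using h) _ ?_
        ENNReal.ofReal_ne_top).symm
      rw [hF _ ht1, ← ENNReal.ofReal_add hb0 ht1.le]
      exact ENNReal.ofReal_le_ofReal (by linarith)
  let h : ℝ → ℝ≥0∞ := fun y =>
    if s < b + y ∧ b + y ≤ t then H r (ENNReal.ofReal (b + y)) else 0
  have hhm : Measurable h := by
    have hby : Measurable fun y : ℝ => b + y := measurable_id.const_add b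
    exact Measurable.ite ((measurableSet_lt measurable_const hby).inter
      (measurableSet_le hby measurable_const))
      (hHm.comp (measurable_const.prodMk hby.ennreal_ofReal)) measurable_const
  trans ∫⁻ x, h x ∂(expMeasure μ)
  · refine lintegral_congr_ae ?_
    filter_upwards [ae_pos_expMeasure (μ := μ)] with x hx
    have hbx : 0 < b + x := by linarith
    rw [hF x hx, ← ENNReal.ofReal_add hb0 hx.le]
    simp only [ENNReal.ofReal_lt_ofReal_iff hbx, ENNReal.ofReal_le_ofReal_iff (hs.trans hst), h]
    split_ifs with hc
    · exact hHr x hx _ hbx.le hc.2 le_rfl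
    · rfl
  · rw [lintegral_expMeasure hμ hhm]
    refine lintegral_congr_ae ?_
    filter_upwards [ae_pos_expMeasure (μ := μ)] with x hx
    have hbx : 0 < b + x := by linarith
    congr 1
    rw [← lintegral_indicator measurableSet_Ico, ← lintegral_indicator measurableSet_Ioc]
    refine Eq.trans ?_ (lintegral_add_left_eq_self _ b)
    refine lintegral_congr fun y => ?_
    rw [hF x hx, hB x hx, ← ENNReal.ofReal_add hb0 hx.le]
    simp only [Set.indicator_apply, Set.mem_Ico, Set.mem_Ioc, h]
    by_cases h1 : s < b + y ∧ b + y ≤ t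
    · have hby : 0 ≤ b + y := hs.trans h1.1.le
      rw [if_pos h1, if_pos h1]
      simp only [ENNReal.ofReal_le_ofReal_iff hby, ENNReal.ofReal_lt_ofReal_iff hbx]
      by_cases h2 : 0 ≤ y ∧ y < x
      · rw [if_pos h2, if_pos ⟨by linarith, by linarith⟩]
        exact (hHr x hx _ hby h1.2 (by linarith)).symm
      · rw [if_neg h2, if_neg]
        exact fun h3 => h2 ⟨by linarith, by linarith⟩
    · simp [h1]

/-- Almost surely, no two threads finish at the same time. -/
lemma ae_finishTime_ne [Countable ι] {μ : ℝ} (hμ : 0 < μ) {S : (ι → ℝ) → ι → ℝ≥0∞}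
    (hS : Causal S) (hSm : ∀ q, Measurable fun d => S d q) :
    ∀ᵐ d ∂(Measure.infinitePi fun _ : ι => expMeasure μ), ∀ p q, q ≠ p →
      finishTime S d p ≠ ⊤ → finishTime S d q ≠ finishTime S d p := by
  have : IsProbabilityMeasure (expMeasure μ) := isProbabilityMeasure_expMeasure hμ
  have hFm := measurable_finishTime hSm
  rw [ae_all_iff]
  intro p
  rw [ae_all_iff]
  intro q
  by_cases hqp : q = p
  · exact Eventually.of_forall fun _ h => absurd hqp h
  have hfix : ∀ N : ℕ, ∀ᵐ d ∂(Measure.infinitePi fun _ : ι => expMeasure μ),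
      finishTime S d p ≤ ENNReal.ofReal N → 0 < finishTime S d p →
        finishTime S d q ≠ finishTime S d p := by
    intro N
    have hm : MeasurableSet {z : (ι → ℝ) × ℝ≥0∞ | finishTime S z.1 q = z.2} :=
      measurableSet_eq_fun ((hFm q).comp measurable_fst) measurable_snd
    have key := lintegral_completion hμ hS hSm p
      (H := fun d τ => if finishTime S d q = τ then 1 else 0)
      (Measurable.ite hm measurable_const measurable_const) (by
        intro d d' hd hd' hoff hle τ hτ hτ'
        simp only [hS.finishTime_eq_iff hd hd' hoff hle hqp hτ hτ']) le_rfl (Nat.cast_nonneg N)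
    have hzero : ∀ d : ι → ℝ, ∫⁻ τ in Set.Ioc (0 : ℝ) N,
        (if S d p ≤ ENNReal.ofReal τ ∧ ENNReal.ofReal τ < finishTime S d p
        then (if finishTime S d q = ENNReal.ofReal τ then 1 else 0) else 0 : ℝ≥0∞) = 0 := by
      intro d
      rw [← lintegral_indicator measurableSet_Ioc]
      refine (lintegral_congr_ae ?_).trans lintegral_zero
      filter_upwards [compl_mem_ae_iff.2 (measure_singleton (finishTime S d q).toReal)] with τ hτ
      by_cases h0 : τ ∈ Set.Ioc (0 : ℝ) N
      · rw [Set.indicator_of_mem h0]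
        refine (ite_congr rfl (fun _ => if_neg fun h => ?_) fun _ => rfl).trans (ite_self 0)
        refine hτ ?_
        rw [Set.mem_singleton_iff, h, ENNReal.toReal_ofReal h0.1.le]
      · rw [Set.indicator_of_notMem h0]
    simp only [hzero, mul_zero, lintegral_zero] at key
    rw [lintegral_eq_zero_iff] at key
    · filter_upwards [key] with d hd h1 h2 h3
      change (if _ then _ else _) = (0 : ℝ≥0∞) at hd
      rw [if_pos ⟨by simpa using h2, h1⟩, if_pos h3] at hd
      exact one_ne_zero hd
    · exact Measurable.ite ((measurableSet_lt measurable_const (hFm p)).inter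
        (measurableSet_le (hFm p) measurable_const))
        (Measurable.ite (measurableSet_eq_fun (hFm q) (hFm p)) measurable_const measurable_const)
        measurable_const
  filter_upwards [ae_all_iff.2 hfix, ae_pos_infinitePi (ι := ι) hμ] with d hd hpos _ hne
  obtain ⟨N, hN⟩ := ENNReal.exists_nat_gt hne
  refine hd N (by simpa using hN.le) ?_
  exact (ENNReal.ofReal_pos.2 (hpos p)).trans_le le_add_self

end Intensity

/-! ### The backlog of chunks -/

section Backlog

variable {n : ℕ} {k N : ℕ} {f g : ℕ × Fin n → ℝ≥0∞} {s t : ℝ≥0∞}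

/-- The number of chunks of the first `N` requests that are still missing at time `t` if the
threads finish at the times `f`. Requests which arrive after `t` contribute `k` chunks each, and
the threads of a request that finish after its departure do not count, by the truncated
subtraction. -/
noncomputable def backlog (k N : ℕ) (f : ℕ × Fin n → ℝ≥0∞) (t : ℝ≥0∞) : ℕ :=
  ∑ i ∈ Finset.range N, (k - numLE (fun j => f (i, j)) t)

lemma backlog_antitone : Antitone (backlog k N f) := fun _ _ h =>
  Finset.sum_le_sum fun _ _ => Nat.sub_le_sub_left (numLE_mono _ h) _

lemma backlog_mono (h : ∀ p, f p ≤ g p) (t : ℝ≥0∞) : backlog k N f t ≤ backlog k N g t :=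
  Finset.sum_le_sum fun _ _ => Nat.sub_le_sub_left (numLE_anti (fun _ => h _) t) _

lemma backlog_le (f : ℕ × Fin n → ℝ≥0∞) (t : ℝ≥0∞) : backlog k N f t ≤ N * k := by
  refine (Finset.sum_le_sum fun _ _ => Nat.sub_le _ _).trans ?_
  simp

lemma backlog_congr (h : ∀ p : ℕ × Fin n, p.1 < N → (f p ≤ s ↔ g p ≤ t)) :
    backlog k N f s = backlog k N g t :=
  Finset.sum_congr rfl fun i hi => by
    rw [numLE_congr fun j => h (i, j) (Finset.mem_range.1 hi)]

lemma le_update_top (p : ℕ × Fin n) (q : ℕ × Fin n) : f q ≤ Function.update f p ⊤ q := by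
  rcases eq_or_ne q p with rfl | h
  · simp
  · simp [Function.update_of_ne h]

/-- Before a thread finishes, it makes no difference whether it ever will. -/
lemma update_top_le_iff {p : ℕ × Fin n} (h : t < f p) (q : ℕ × Fin n) :
    Function.update f p ⊤ q ≤ t ↔ f q ≤ t := by
  rcases eq_or_ne q p with rfl | hne
  · simp [h, h.ne_top]
  · simp [Function.update_of_ne hne]

lemma numLE_update_top {p : ℕ × Fin n} (h : f p ≤ t) (ht : t ≠ ⊤) :
    numLE (fun j => f (p.1, j)) t =
      numLE (fun j => Function.update f p ⊤ (p.1, j)) t + 1 := by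
  unfold numLE
  rw [← Finset.card_insert_of_notMem (a := p.2)]
  · congr 1
    ext j
    rcases eq_or_ne j p.2 with rfl | hne
    · simp [h]
    · have : (p.1, j) ≠ p := fun h' => hne (congrArg Prod.snd h')
      simp [Function.update_of_ne this, hne]
  · simp [ht]

lemma backlog_eq_erase {i : ℕ} (hi : i < N) (f : ℕ × Fin n → ℝ≥0∞) (t : ℝ≥0∞) :
    backlog k N f t = ∑ i' ∈ (Finset.range N).erase i, (k - numLE (fun j => f (i', j)) t) +
      (k - numLE (fun j => f (i, j)) t) :=
  (Finset.sum_erase_add _ _ (Finset.mem_range.2 hi)).symm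

lemma backlog_update_top {p : ℕ × Fin n} (hp : p.1 < N) (h : f p ≤ t) (ht : t ≠ ⊤) :
    backlog k N (Function.update f p ⊤) t = backlog k N f t +
      if numLE (fun j => Function.update f p ⊤ (p.1, j)) t < k then 1 else 0 := by
  have hrest : ∑ i ∈ (Finset.range N).erase p.1,
        (k - numLE (fun j => Function.update f p ⊤ (i, j)) t) =
      ∑ i ∈ (Finset.range N).erase p.1, (k - numLE (fun j => f (i, j)) t) := by
    refine Finset.sum_congr rfl fun i hi => ?_
    have : ∀ j, Function.update f p ⊤ (i, j) = f (i, j) := fun j =>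
      Function.update_of_ne (fun h' => Finset.ne_of_mem_erase hi (congrArg Prod.fst h')) _ _
    simp only [this]
  rw [backlog_eq_erase hp, backlog_eq_erase hp, hrest, numLE_update_top h ht]
  split_ifs <;> omega

/-- If the backlog falls below `m` during `(s, t]`, it does so when some thread finishes. -/
lemma exists_finish_of_backlog_lt {m : ℕ} (hs : m ≤ backlog k N f s) (ht : backlog k N f t < m) :
    ∃ p : ℕ × Fin n, p.1 < N ∧ s < f p ∧ f p ≤ t ∧ backlog k N f (f p) < m := by
  have hst : s ≤ t := by
    by_contra! h
    exact absurd ((backlog_antitone h.le).trans_lt ht) (not_lt.2 hs)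
  set A := (Finset.range N ×ˢ (Finset.univ : Finset (Fin n))).filter
    fun p => s < f p ∧ f p ≤ t with hA
  have hmem : ∀ p, p ∈ A ↔ p.1 < N ∧ s < f p ∧ f p ≤ t := fun p => by simp [hA]
  rcases A.eq_empty_or_nonempty with he | hne
  · have : backlog k N f s = backlog k N f t := by
      refine backlog_congr fun p hp => ⟨fun h => h.trans hst, fun h => ?_⟩
      by_contra! h'
      exact Finset.notMem_empty p (he ▸ (hmem p).2 ⟨hp, h', h⟩)
    omega
  · obtain ⟨p, hpA, hp⟩ := A.exists_max_image f hne
    obtain ⟨hpN, hps, hpt⟩ := (hmem p).1 hpA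
    refine ⟨p, hpN, hps, hpt, ?_⟩
    have : backlog k N f (f p) = backlog k N f t := by
      refine backlog_congr fun q hq => ⟨fun h => h.trans hpt, fun h => ?_⟩
      by_cases h' : s < f q
      · exact hp q ((hmem q).2 ⟨hq, h', h⟩)
      · exact (not_lt.1 h').trans hps.le
    omega

/-- A completion of the thread `p` at time `t` brings the backlog from `m` down to `m - 1`: this
is a condition on the other threads, so `p` is made to take forever. -/
def IsCrossing (k N : ℕ) (f : ℕ × Fin n → ℝ≥0∞) (m : ℕ) (p : ℕ × Fin n) (t : ℝ≥0∞) : Prop :=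
  backlog k N (Function.update f p ⊤) t = m ∧
    numLE (fun j => Function.update f p ⊤ (p.1, j)) t < k

lemma IsCrossing.backlog_lt {m : ℕ} {p : ℕ × Fin n} (hp : p.1 < N) (ht : f p ≠ ⊤)
    (h : IsCrossing k N f m p (f p)) : backlog k N f (f p) < m := by
  have := backlog_update_top (k := k) hp le_rfl ht
  rw [h.1, if_pos h.2] at this
  omega

open Classical in
/-- If no two threads finish at the same time, then the backlog falls from `m` to `m - 1` at most
once, and it does so during `(s, t]` exactly if it is at least `m` at time `s` and less than `m` at
time `t`. -/
lemma sum_isCrossing (hinj : ∀ p q, q ≠ p → f p ≠ ⊤ → f q ≠ f p) (ht : t ≠ ⊤) (m : ℕ) :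
    ∑ p ∈ Finset.range N ×ˢ (Finset.univ : Finset (Fin n)),
      (if s < f p ∧ f p ≤ t then (if IsCrossing k N f m p (f p) then 1 else 0) else 0 : ℝ≥0∞) =
      if m ≤ backlog k N f s ∧ backlog k N f t < m then 1 else 0 := by
  have hP : ∀ p : ℕ × Fin n, p ∈ Finset.range N ×ˢ (Finset.univ : Finset (Fin n)) ↔ p.1 < N :=
    fun p => by simp
  split_ifs with hc
  · obtain ⟨p₀, hp₀⟩ := exists_finish_of_backlog_lt hc.1 hc.2
    set A := (Finset.range N ×ˢ (Finset.univ : Finset (Fin n))).filter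
      fun p => s < f p ∧ f p ≤ t ∧ backlog k N f (f p) < m with hA
    have hmem : ∀ p, p ∈ A ↔ p.1 < N ∧ s < f p ∧ f p ≤ t ∧ backlog k N f (f p) < m :=
      fun p => by rw [hA, Finset.mem_filter, hP]
    obtain ⟨p, hpA, hmin⟩ := A.exists_min_image f ⟨p₀, (hmem _).2 hp₀⟩
    obtain ⟨hpN, hps, hpt, hpm⟩ := (hmem p).1 hpA
    have hfp := ne_top_of_le_ne_top ht hpt
    have hge : m ≤ backlog k N (Function.update f p ⊤) (f p) := by
      by_contra! hlt
      have hs' : m ≤ backlog k N (Function.update f p ⊤) s :=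
        hc.1.trans (backlog_mono (le_update_top p) s)
      obtain ⟨q, hqN, hqs, hqp, hqm⟩ := exists_finish_of_backlog_lt hs' hlt
      have hne : q ≠ p := by
        rintro rfl
        rw [Function.update_self] at hqp
        exact hfp (top_le_iff.1 hqp)
      rw [Function.update_of_ne hne] at hqs hqp hqm
      exact hinj p q hne hfp (le_antisymm hqp (hmin q ((hmem q).2
        ⟨hqN, hqs, hqp.trans hpt, (backlog_mono (le_update_top p) _).trans_lt hqm⟩)))
    have hcross : IsCrossing k N f m p (f p) := by
      have h := backlog_update_top (k := k) hpN le_rfl hfp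
      split_ifs at h with hlt
      · exact ⟨by omega, hlt⟩
      · omega
    rw [Finset.sum_eq_single_of_mem p ((hP p).2 hpN), if_pos ⟨hps, hpt⟩, if_pos hcross]
    intro q hq hqp
    by_contra hne
    have hq' : (s < f q ∧ f q ≤ t) ∧ IsCrossing k N f m q (f q) := by
      by_contra h
      rw [not_and_or] at h
      rcases h with h | h
      · exact hne (if_neg h)
      · exact hne (by rw [if_neg h, ite_self])
    have hqt := ne_top_of_le_ne_top ht hq'.1.2
    have hqm := hq'.2.backlog_lt ((hP q).1 hq) hqt
    have hlt : f p < f q := lt_of_le_of_ne (hmin q ((hmem q).2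
      ⟨(hP q).1 hq, hq'.1.1, hq'.1.2, hqm⟩)) (hinj p q hqp hfp).symm
    have h1 : backlog k N (Function.update f q ⊤) (f p) = backlog k N f (f p) :=
      backlog_congr fun r _ => update_top_le_iff hlt r
    have h2 := backlog_antitone (k := k) (N := N) (f := Function.update f q ⊤) hlt.le
    rw [hq'.2.1, h1] at h2
    omega
  · refine Finset.sum_eq_zero fun p hp => ?_
    split_ifs with h1 h2
    · refine absurd ⟨?_, ?_⟩ hc
      · have h3 := backlog_antitone (k := k) (N := N) (f := Function.update f p ⊤) h1.1.le
        rwa [h2.1, backlog_congr fun r _ => update_top_le_iff h1.1 r] at h3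
      · exact (backlog_antitone h1.2).trans_lt
          (h2.backlog_lt ((hP p).1 hp) (ne_top_of_le_ne_top ht h1.2))
    · rfl
    · rfl

lemma measurable_backlog {α : Type*} [MeasurableSpace α] {f : α → ℕ × Fin n → ℝ≥0∞}
    {t : α → ℝ≥0∞} (hf : ∀ p, Measurable fun a => f a p) (ht : Measurable t) :
    Measurable fun a => backlog k N (f a) (t a) :=
  Finset.measurable_sum _ fun i _ => measurable_const.sub (measurable_numLE (fun j => hf (i, j)) ht)

end Backlog

/-! ### The drift of the backlog -/

section Drift

variable {n : ℕ} {k N : ℕ} {μ : ℝ} {S : (ℕ × Fin n → ℝ) → ℕ × Fin n → ℝ≥0∞}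

open Classical in
/-- The number of threads that are downloading chunks of the first `N` requests at time `t`. -/
noncomputable def activeCount (k N : ℕ) (S : (ℕ × Fin n → ℝ) → ℕ × Fin n → ℝ≥0∞)
    (d : ℕ × Fin n → ℝ) (t : ℝ≥0∞) : ℕ :=
  ((Finset.range N ×ˢ (Finset.univ : Finset (Fin n))).filter fun p =>
    S d p ≤ t ∧ t < finishTime S d p ∧ numLE (fun j => finishTime S d (p.1, j)) t < k).card

lemma measurable_activeCount (hSm : ∀ q, Measurable fun d => S d q) :
    Measurable fun z : (ℕ × Fin n → ℝ) × ℝ≥0∞ => activeCount k N S z.1 z.2 := by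
  unfold activeCount
  simp only [Finset.card_filter]
  refine Finset.measurable_sum _ fun p _ => Measurable.ite ?_ measurable_const measurable_const
  have hF : ∀ q, Measurable fun z : (ℕ × Fin n → ℝ) × ℝ≥0∞ => finishTime S z.1 q :=
    fun q => (measurable_finishTime hSm q).comp measurable_fst
  exact (measurableSet_le ((hSm p).comp measurable_fst) measurable_snd).inter
    ((measurableSet_lt measurable_snd (hF p)).inter
      (measurableSet_lt (measurable_numLE (fun j => hF (p.1, j)) measurable_snd) measurable_const))

open Classical in
/-- The backlog leaves the level `m` with intensity `μ` times the number of active threads. -/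
lemma measure_backlog_crossing (hμ : 0 < μ) (hS : Causal S)
    (hSm : ∀ q, Measurable fun d => S d q) (m : ℕ) {s t : ℝ} (hs : 0 ≤ s) (hst : s ≤ t) :
    (Measure.infinitePi fun _ : ℕ × Fin n => expMeasure μ)
      {d | m ≤ backlog k N (finishTime S d) (ENNReal.ofReal s) ∧
        backlog k N (finishTime S d) (ENNReal.ofReal t) < m} =
      ENNReal.ofReal μ * ∫⁻ τ in Set.Ioc s t,
        ∫⁻ d, (if backlog k N (finishTime S d) (ENNReal.ofReal τ) = m
          then (activeCount k N S d (ENNReal.ofReal τ) : ℝ≥0∞) else 0)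
          ∂(Measure.infinitePi fun _ : ℕ × Fin n => expMeasure μ) := by
  have : IsProbabilityMeasure (expMeasure μ) := isProbabilityMeasure_expMeasure hμ
  set P := Measure.infinitePi fun _ : ℕ × Fin n => expMeasure μ with hP
  have hF := measurable_finishTime hSm
  have hF1 : ∀ q, Measurable fun z : (ℕ × Fin n → ℝ) × ℝ≥0∞ => finishTime S z.1 q :=
    fun q => (hF q).comp measurable_fst
  have hU : ∀ p q : ℕ × Fin n, Measurable fun z : (ℕ × Fin n → ℝ) × ℝ≥0∞ =>
      Function.update (finishTime S z.1) p ⊤ q := by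
    intro p q
    rcases eq_or_ne q p with rfl | h
    · simp only [Function.update_self, measurable_const]
    · simp only [Function.update_of_ne h]
      exact hF1 q
  have hHm : ∀ p, Measurable (Function.uncurry fun d t =>
      if IsCrossing k N (finishTime S d) m p t then (1 : ℝ≥0∞) else 0) := by
    intro p
    exact Measurable.ite ((measurableSet_eq_fun (measurable_backlog (hU p) measurable_snd)
      measurable_const).inter (measurableSet_lt (measurable_numLE (fun j => hU p (p.1, j))
      measurable_snd) measurable_const)) measurable_const measurable_const
  have hint : ∀ p, Measurable fun d : ℕ × Fin n → ℝ =>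
      if ENNReal.ofReal s < finishTime S d p ∧ finishTime S d p ≤ ENNReal.ofReal t then
        (if IsCrossing k N (finishTime S d) m p (finishTime S d p) then (1 : ℝ≥0∞) else 0)
        else 0 := fun p =>
    measurable_mark_finish (hHm p) (hF p) s t
  have hact : ∀ p, Measurable fun z : (ℕ × Fin n → ℝ) × ℝ =>
      if S z.1 p ≤ ENNReal.ofReal z.2 ∧ ENNReal.ofReal z.2 < finishTime S z.1 p then
        (if IsCrossing k N (finishTime S z.1) m p (ENNReal.ofReal z.2) then (1 : ℝ≥0∞) else 0)
        else 0 := fun p =>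
    measurable_mark_active (hHm p) (hSm p) (hF p)
  have hZ : Measurable fun z : (ℕ × Fin n → ℝ) × ℝ =>
      if backlog k N (finishTime S z.1) (ENNReal.ofReal z.2) = m
        then (activeCount k N S z.1 (ENNReal.ofReal z.2) : ℝ≥0∞) else 0 :=
    Measurable.ite (measurableSet_eq_fun (measurable_backlog
      (fun q => (hF q).comp measurable_fst) measurable_snd.ennreal_ofReal) measurable_const)
      (measurable_from_top.comp ((measurable_activeCount hSm).comp
        (measurable_fst.prodMk measurable_snd.ennreal_ofReal))) measurable_const
  have hcompl := fun p => lintegral_completion hμ hS hSm p (hHm p) (by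
    intro d d' hd hd' hoff hle t ht htop
    have hU' : ∀ q, Function.update (finishTime S d) p ⊤ q ≤ t ↔
        Function.update (finishTime S d') p ⊤ q ≤ t := by
      intro q
      rcases eq_or_ne q p with rfl | hq
      · simp
      · rw [Function.update_of_ne hq, Function.update_of_ne hq]
        exact hS.finishTime_le_iff hd hd' hoff hle hq ht htop
    have hiff : IsCrossing k N (finishTime S d) m p t ↔ IsCrossing k N (finishTime S d') m p t := by
      rw [IsCrossing, IsCrossing, backlog_congr fun q _ => hU' q, numLE_congr fun j => hU' (p.1, j)]
    simp only [hiff]) hs hst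
  calc P {d | m ≤ backlog k N (finishTime S d) (ENNReal.ofReal s) ∧
        backlog k N (finishTime S d) (ENNReal.ofReal t) < m}
      = ∫⁻ d, (if m ≤ backlog k N (finishTime S d) (ENNReal.ofReal s) ∧
          backlog k N (finishTime S d) (ENNReal.ofReal t) < m then 1 else 0) ∂P := by
        rw [← lintegral_indicator_one]
        · exact lintegral_congr fun d => by simp only [Set.indicator_apply, Pi.one_apply]; rfl
        · exact (measurableSet_le measurable_const (measurable_backlog hF measurable_const)).inter
            (measurableSet_lt (measurable_backlog hF measurable_const) measurable_const)
    _ = ∫⁻ d, ∑ p ∈ Finset.range N ×ˢ (Finset.univ : Finset (Fin n)),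
          (if ENNReal.ofReal s < finishTime S d p ∧ finishTime S d p ≤ ENNReal.ofReal t then
            (if IsCrossing k N (finishTime S d) m p (finishTime S d p) then 1 else 0)
            else 0) ∂P := by
        refine lintegral_congr_ae ?_
        filter_upwards [ae_finishTime_ne hμ hS hSm] with d hd
        exact (sum_isCrossing hd ENNReal.ofReal_ne_top m).symm
    _ = ∫⁻ d, (ENNReal.ofReal μ * ∫⁻ τ in Set.Ioc s t,
          ∑ p ∈ Finset.range N ×ˢ (Finset.univ : Finset (Fin n)),
          if S d p ≤ ENNReal.ofReal τ ∧ ENNReal.ofReal τ < finishTime S d p then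
            (if IsCrossing k N (finishTime S d) m p (ENNReal.ofReal τ) then 1 else 0)
            else 0) ∂P := by
        rw [lintegral_finsetSum _ fun p _ => hint p, Finset.sum_congr rfl fun p _ => hcompl p,
          ← lintegral_finsetSum]
        · refine lintegral_congr fun d => ?_
          rw [← Finset.mul_sum]
          exact congrArg _ (lintegral_finsetSum _ fun p _ =>
            (hact p).comp measurable_prodMk_left).symm
        · exact fun p _ => measurable_const.mul (Measurable.lintegral_prod_right' (hact p))
    _ = ∫⁻ d, (ENNReal.ofReal μ * ∫⁻ τ in Set.Ioc s t,
          (if backlog k N (finishTime S d) (ENNReal.ofReal τ) = m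
          then (activeCount k N S d (ENNReal.ofReal τ) : ℝ≥0∞) else 0)) ∂P := by
        refine lintegral_congr fun d => congrArg _ (lintegral_congr fun τ => ?_)
        rw [activeCount, Finset.card_filter, Nat.cast_sum]
        have hcr : ∀ p, ENNReal.ofReal τ < finishTime S d p →
            (IsCrossing k N (finishTime S d) m p (ENNReal.ofReal τ) ↔
              backlog k N (finishTime S d) (ENNReal.ofReal τ) = m ∧
                numLE (fun j => finishTime S d (p.1, j)) (ENNReal.ofReal τ) < k) := by
          intro p hp
          rw [IsCrossing, backlog_congr fun q _ => update_top_le_iff hp q,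
            numLE_congr fun j => update_top_le_iff hp (p.1, j)]
        by_cases hm : backlog k N (finishTime S d) (ENNReal.ofReal τ) = m
        · rw [if_pos hm]
          refine Finset.sum_congr rfl fun p _ => ?_
          by_cases hp : S d p ≤ ENNReal.ofReal τ ∧ ENNReal.ofReal τ < finishTime S d p
          · simp [hp, hcr p hp.2, hm]
          · rw [if_neg hp, if_neg fun h => hp ⟨h.1, h.2.1⟩, Nat.cast_zero]
        · rw [if_neg hm]
          refine Finset.sum_eq_zero fun p _ => ?_
          by_cases hp : S d p ≤ ENNReal.ofReal τ ∧ ENNReal.ofReal τ < finishTime S d p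
          · simp [hcr p hp.2, hm]
          · rw [if_neg hp]
    _ = _ := by
        rw [lintegral_const_mul' _ _ ENNReal.ofReal_ne_top, lintegral_lintegral_swap]
        exact hZ.aemeasurable

end Drift

/-! ### Comparison of two tail functions -/

/-- Let `u m` and `g m` be the tails `P (W ≥ m)` of two nonincreasing integer-valued processes,
with `pu m` and `pg m` the probabilities of `W = m`. If the first one leaves the level `m` at most
with intensity `c χ m` and the second one at least with this intensity, then `g ≤ u` persists. -/
lemma tail_le_tail_of_drift {c : ℝ≥0∞} (hc : c ≠ ⊤) {χ u pu g pg : ℕ → ℝ → ℝ≥0∞}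
    (hχ : ∀ m τ, χ m τ ≤ 1) (hu1 : ∀ m τ, u m τ ≤ 1)
    (hpu : ∀ m τ, u m τ = pu m τ + u (m + 1) τ) (hpg : ∀ m τ, g m τ = pg m τ + g (m + 1) τ)
    (h0 : ∀ m, g m 0 ≤ u m 0) {M : ℕ} (hM : ∀ m, M ≤ m → ∀ τ, g m τ = 0)
    (hu : ∀ m s t, 0 ≤ s → s ≤ t →
      u m s ≤ u m t + c * ∫⁻ τ in Set.Ioc s t, χ m τ * pu m τ)
    (hg : ∀ m s t, 0 ≤ s → s ≤ t →
      g m t + c * ∫⁻ τ in Set.Ioc s t, χ m τ * pg m τ ≤ g m s)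
    (m : ℕ) {t : ℝ} (ht : 0 ≤ t) : g m t ≤ u m t := by
  suffices h : ∀ r m, M ≤ m + r → ∀ t, 0 ≤ t → g m t ≤ u m t from h M m (by omega) t ht
  intro r
  induction r with
  | zero =>
    intro m hm t _
    simp [hM m hm]
  | succ r ih =>
    intro m hm t ht
    have ih' := ih (m + 1) (by omega)
    by_contra! hlt
    -- consider the last time before `t` at which the inequality holds
    set A := {τ : ℝ | (0 ≤ τ ∧ τ ≤ t) ∧ g m τ ≤ u m τ} with hA
    have hAne : A.Nonempty := ⟨0, ⟨le_rfl, ht⟩, h0 m⟩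
    have hAbdd : BddAbove A := ⟨t, fun τ hτ => hτ.1.2⟩
    set r₁ := sSup A with hr₁
    have hr0 : 0 ≤ r₁ := le_csSup hAbdd ⟨⟨le_rfl, ht⟩, h0 m⟩
    have hrt : r₁ ≤ t := csSup_le hAne fun τ hτ => hτ.1.2
    have hpu1 : ∀ τ, pu m τ ≤ 1 := fun τ => (le_self_add.trans (hpu m τ).ge).trans (hu1 m τ)
    have hr : g m r₁ ≤ u m r₁ := by
      refine ENNReal.le_of_forall_pos_le_add fun ε hε _ => ?_
      set δ : ℝ := ε / (c.toReal + 1) with hδ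
      have hc0 : 0 ≤ c.toReal := ENNReal.toReal_nonneg
      have hδ0 : 0 < δ := div_pos hε (by linarith)
      obtain ⟨τ, hτA, hτ⟩ := exists_lt_of_lt_csSup hAne (show r₁ - δ < sSup A by linarith)
      have hτr : τ ≤ r₁ := le_csSup hAbdd hτA
      calc g m r₁ ≤ g m τ := le_self_add.trans (hg m τ r₁ hτA.1.1 hτr)
        _ ≤ u m τ := hτA.2
        _ ≤ u m r₁ + c * ∫⁻ τ in Set.Ioc τ r₁, χ m τ * pu m τ := hu m τ r₁ hτA.1.1 hτr
        _ ≤ u m r₁ + ε := by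
          gcongr
          calc c * ∫⁻ τ in Set.Ioc τ r₁, χ m τ * pu m τ ≤ c * ∫⁻ _ in Set.Ioc τ r₁, 1 := by
                gcongr with x
                exact mul_le_one' (hχ m x) (hpu1 x)
            _ = c * ENNReal.ofReal (r₁ - τ) := by simp
            _ ≤ ENNReal.ofReal c.toReal * ENNReal.ofReal δ := by
                rw [ENNReal.ofReal_toReal hc]
                gcongr
                linarith
            _ = ENNReal.ofReal (c.toReal * δ) := (ENNReal.ofReal_mul hc0).symm
            _ ≤ ENNReal.ofReal ε := by
                refine ENNReal.ofReal_le_ofReal ?_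
                rw [hδ, mul_div_assoc', div_le_iff₀ (by linarith)]
                nlinarith [ε.coe_nonneg]
            _ = ε := ENNReal.ofReal_coe_nnreal
    have hle : ∀ τ ∈ Set.Ioc r₁ t, χ m τ * pu m τ ≤ χ m τ * pg m τ := by
      intro τ hτ
      have hτA : u m τ < g m τ := by
        by_contra! h
        exact absurd (le_csSup hAbdd ⟨⟨hr0.trans hτ.1.le, hτ.2⟩, h⟩) (not_le.2 hτ.1)
      gcongr
      rw [hpu, hpg] at hτA
      have h1 : pu m τ + u (m + 1) τ ≤ pg m τ + u (m + 1) τ :=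
        hτA.le.trans (add_le_add_right (ih' τ (hr0.trans hτ.1.le)) _)
      exact (ENNReal.add_le_add_iff_right (ne_top_of_le_ne_top ENNReal.one_ne_top
        (hu1 (m + 1) τ))).1 h1
    set I := c * ∫⁻ τ in Set.Ioc r₁ t, χ m τ * pg m τ with hI
    have h1 : g m t + I ≤ u m t + I := by
      calc g m t + I ≤ g m r₁ := hg m r₁ t hr0 hrt
        _ ≤ u m r₁ := hr
        _ ≤ _ := hu m r₁ t hr0 hrt
        _ ≤ u m t + I := by
          gcongr 1
          exact mul_le_mul_right (setLIntegral_mono' measurableSet_Ioc hle) c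
    have hItop : I ≠ ⊤ := ne_top_of_le_ne_top ENNReal.one_ne_top
      (((le_add_self.trans (hg m r₁ t hr0 hrt)).trans hr).trans (hu1 m r₁))
    exact absurd ((ENNReal.add_le_add_iff_right hItop).1 h1) (not_le.2 hlt)

/-! ### The backlog and the queue -/

namespace StartRule

variable {n : ℕ} {U : Type*} {k N : ℕ} {S : StartRule n U} {ω : Sample n U} {t : ℝ≥0}

open Classical in
/-- Those of the first `N` requests that are in the system at time `t`. -/
noncomputable def pending (k N : ℕ) (S : StartRule n U) (ω : Sample n U) (t : ℝ≥0) : Finset ℕ :=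
  (Finset.range N).filter fun i => ω.arr i ≤ t ∧ (t : ℝ≥0∞) < S.departure k ω i

lemma mem_pending {i : ℕ} :
    i ∈ S.pending k N ω t ↔ i < N ∧ ω.arr i ≤ t ∧ (t : ℝ≥0∞) < S.departure k ω i := by
  simp [pending]

lemma card_pending_le : (S.pending k N ω t).card ≤ N := by
  classical
  exact (Finset.card_filter_le _ _).trans (Finset.card_range N).le

/-- The earliest pending request is at the head of the line. -/
lemma exists_headOfLine (ha : Monotone ω.arr) (h : (S.pending k N ω t).Nonempty) :
    ∃ i ∈ S.pending k N ω t, (∀ i' ∈ S.pending k N ω t, i ≤ i') ∧ S.HeadOfLine k ω t i := by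
  obtain ⟨i, hi, hmin⟩ := (S.pending k N ω t).exists_min_image id h
  have hi' := mem_pending.1 hi
  refine ⟨i, hi, hmin, hi'.2.1, hi'.2.2, fun i' hlt => ?_⟩
  by_contra! hdep
  exact absurd (hmin i' (mem_pending.2 ⟨hlt.trans hi'.1, (ha hlt.le).trans hi'.2.1, hdep⟩))
    (not_le.2 hlt)

end StartRule

/-- The number of those of the first `N` requests that arrive after time `t`. -/
noncomputable def numFuture (N : ℕ) (a : ℕ → ℝ≥0) (t : ℝ≥0) : ℕ :=
  ((Finset.range N).filter fun i => t < a i).card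

namespace OnlineScheme

variable {L n k N : ℕ} {U : Type*} [MeasurableSpace U] {σ : OnlineScheme L n k U}
  {a : ℕ → ℝ≥0} {d : ℕ × Fin n → ℝ} {u : U} {t : ℝ≥0}

/-- The starting times of a scheme as a function of the downloading times alone. -/
def startOf (σ : OnlineScheme L n k U) (a : ℕ → ℝ≥0) (u : U) (d : ℕ × Fin n → ℝ) :
    ℕ × Fin n → ℝ≥0∞ :=
  σ.start ⟨a, d, u⟩

/-- The number of missing chunks of the first `N` requests at time `t` under a scheme. -/
noncomputable def backlogOf (σ : OnlineScheme L n k U) (N : ℕ) (a : ℕ → ℝ≥0) (u : U) (t : ℝ≥0)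
    (d : ℕ × Fin n → ℝ) : ℕ :=
  backlog k N (finishTime (σ.startOf a u) d) t

lemma backlogOf_eq (h : Sample.Regular (⟨a, d, u⟩ : Sample n U)) :
    σ.backlogOf N a u t d = numFuture N a t * k +
      ∑ i ∈ σ.start.pending k N ⟨a, d, u⟩ t,
        (k - numLE (fun j => σ.start.finish ⟨a, d, u⟩ (i, j)) t) := by
  have hfut : numFuture N a t * k = ∑ i ∈ Finset.range N, if t < a i then k else 0 := by
    rw [numFuture, Finset.card_filter, Finset.sum_mul]
    exact Finset.sum_congr rfl fun i _ => by split_ifs <;> simp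
  rw [backlogOf, backlog, hfut, StartRule.pending, Finset.sum_filter, ← Finset.sum_add_distrib]
  refine Finset.sum_congr rfl fun i _ => ?_
  change k - numLE (fun j => σ.start.finish ⟨a, d, u⟩ (i, j)) t = _
  by_cases hi : t < a i
  · have h0 : numLE (fun j => σ.start.finish ⟨a, d, u⟩ (i, j)) t = 0 := by
      refine Finset.card_eq_zero.2 (Finset.filter_eq_empty_iff.2 fun j _ => not_le.2 ?_)
      exact (ENNReal.coe_lt_coe.2 hi).trans_le ((σ.arr_le_start _ h i j).trans le_self_add)
    rw [if_pos hi, if_neg fun h' => absurd h'.1 (not_le.2 hi), h0]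
    rfl
  · rw [if_neg hi]
    split_ifs with h'
    · rw [zero_add]
    · have : ¬ numLE (fun j => σ.start.finish ⟨a, d, u⟩ (i, j)) t < k :=
        fun h'' => h' ⟨not_lt.1 hi, (StartRule.lt_departure_iff ENNReal.coe_ne_top).2 h''⟩
      omega

lemma activeCount_eq_encard : (activeCount k N (σ.startOf a u) d t : ℕ∞) =
    {p | p.1 < N ∧ σ.start.Active k ⟨a, d, u⟩ t p}.encard := by
  classical
  rw [activeCount, ← Set.encard_coe_eq_coe_finsetCard]
  congr 1
  ext p
  simp only [Finset.coe_filter, Finset.mem_product, Finset.mem_range, Finset.mem_univ, and_true,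
    Set.mem_ofPred_eq, StartRule.Active, StartRule.lt_departure_iff ENNReal.coe_ne_top]
  rfl

lemma activeCount_le (h : Sample.Regular (⟨a, d, u⟩ : Sample n U)) :
    activeCount k N (σ.startOf a u) d t ≤ L := by
  rw [← Nat.cast_le (α := ℕ∞), activeCount_eq_encard]
  exact (Set.encard_le_encard fun p hp => hp.2).trans (σ.card_active_le _ h t)

/-- Threads can only be active if some request is in the system. -/
lemma numFuture_mul_lt_backlogOf (h : Sample.Regular (⟨a, d, u⟩ : Sample n U))
    (hact : activeCount k N (σ.startOf a u) d t ≠ 0) :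
    numFuture N a t * k < σ.backlogOf N a u t d := by
  have hne : {p | p.1 < N ∧ σ.start.Active k ⟨a, d, u⟩ t p}.Nonempty := by
    rw [← Set.encard_ne_zero, ← activeCount_eq_encard]
    exact_mod_cast hact
  obtain ⟨⟨i, j⟩, hi, hp⟩ := hne
  have harr : a i ≤ t := ENNReal.coe_le_coe.1 ((σ.arr_le_start _ h i j).trans hp.1)
  have hmem : i ∈ σ.start.pending k N ⟨a, d, u⟩ t :=
    StartRule.mem_pending.2 ⟨hi, harr, hp.2.2⟩
  rw [backlogOf_eq h, Nat.lt_add_right_iff_pos]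
  refine lt_of_lt_of_le ?_ (Finset.single_le_sum (fun _ _ => Nat.zero_le _) hmem)
  exact Nat.sub_pos_of_lt ((StartRule.lt_departure_iff ENNReal.coe_ne_top).1 hp.2.2)

/-- A request in the system misses at most `k` chunks. -/
lemma lt_card_pending (h : Sample.Regular (⟨a, d, u⟩ : Sample n U)) {r : ℕ}
    (hr : numFuture N a t * k + r * k + 1 ≤ σ.backlogOf N a u t d) :
    r < (σ.start.pending k N ⟨a, d, u⟩ t).card := by
  rw [backlogOf_eq h] at hr
  have h1 : ∑ i ∈ σ.start.pending k N ⟨a, d, u⟩ t,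
      (k - numLE (fun j => σ.start.finish ⟨a, d, u⟩ (i, j)) t) ≤
      (σ.start.pending k N ⟨a, d, u⟩ t).card * k := by
    rw [← smul_eq_mul, ← Finset.sum_const]
    exact Finset.sum_le_sum fun _ _ => Nat.sub_le _ _
  by_contra! hle
  have := Nat.mul_le_mul_right k hle
  omega

lemma IsGreedy.le_activeCount (hσ : σ.IsGreedy) (h : Sample.Regular (⟨a, d, u⟩ : Sample n U))
    (hlt : numFuture N a t * k < σ.backlogOf N a u t d) :
    L ≤ activeCount k N (σ.startOf a u) d t := by
  rw [backlogOf_eq h, Nat.lt_add_right_iff_pos] at hlt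
  have hne : (σ.start.pending k N ⟨a, d, u⟩ t).Nonempty := by
    rw [Finset.nonempty_iff_ne_empty]
    intro he
    simp [he] at hlt
  obtain ⟨i, hi, -, hhead⟩ := StartRule.exists_headOfLine h.1.1 hne
  rw [← Nat.cast_le (α := ℕ∞), activeCount_eq_encard, ← (hσ _ h t i hhead).1,
    ← (Prod.mk_right_injective i).encard_image]
  refine Set.encard_le_encard ?_
  rintro _ ⟨j, hj, rfl⟩
  exact ⟨(StartRule.mem_pending.1 hi).1, hj⟩

/-- Under a greedy scheme, no chunks of a request behind the head of the line have arrived. -/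
lemma IsGreedy.numLE_eq_zero (hσ : σ.IsGreedy) (h : Sample.Regular (⟨a, d, u⟩ : Sample n U))
    {i₀ i : ℕ} (hi₀ : i₀ ∈ σ.start.pending k N ⟨a, d, u⟩ t)
    (hlt : i₀ < i) :
    numLE (fun j => σ.start.finish ⟨a, d, u⟩ (i, j)) t = 0 := by
  refine Finset.card_eq_zero.2 (Finset.filter_eq_empty_iff.2 fun j _ hj => ?_)
  have hst : σ.start ⟨a, d, u⟩ (i, j) ≤ t := le_self_add.trans hj
  have hne : σ.start ⟨a, d, u⟩ (i, j) ≠ ⊤ := ne_top_of_le_ne_top ENNReal.coe_ne_top hst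
  -- look at the time `s` at which the thread `j` of request `i` has been started
  obtain ⟨s, hs⟩ : ∃ s : ℝ≥0, (s : ℝ≥0∞) = σ.start ⟨a, d, u⟩ (i, j) :=
    ⟨_, ENNReal.coe_toNNReal hne⟩
  rw [← hs] at hst
  have hact : σ.start.Active k ⟨a, d, u⟩ s (i, j) := by
    refine ⟨hs.ge, ?_, ?_⟩
    · rw [hs]
      exact start_lt_finishTime (S := σ.startOf a u) (h.2 (i, j)) hne
    · rw [hs]
      exact σ.start_lt_departure _ h i j (lt_top_iff_ne_top.2 hne)
  have has : a i ≤ s := ENNReal.coe_le_coe.1 ((σ.arr_le_start _ h i j).trans hs.ge)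
  have hmem : i₀ ∈ σ.start.pending k N ⟨a, d, u⟩ s := by
    have := StartRule.mem_pending.1 hi₀
    exact StartRule.mem_pending.2 ⟨this.1, (h.1.1 hlt.le).trans has, hst.trans_lt this.2.2⟩
  obtain ⟨i₁, -, hmin, hhead⟩ := StartRule.exists_headOfLine h.1.1 ⟨i₀, hmem⟩
  exact (hσ _ h s i₁ hhead).2 i j ((hmin i₀ hmem).trans_lt hlt).ne' hact

/-- Under a greedy scheme, all pending requests but the first miss all their `k` chunks. -/
lemma IsGreedy.le_backlogOf (hσ : σ.IsGreedy) (h : Sample.Regular (⟨a, d, u⟩ : Sample n U)) {r : ℕ}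
    (hr : r < (σ.start.pending k N ⟨a, d, u⟩ t).card) :
    numFuture N a t * k + r * k + 1 ≤ σ.backlogOf N a u t d := by
  rw [backlogOf_eq h]
  set Q := σ.start.pending k N ⟨a, d, u⟩ t with hQ
  obtain ⟨i₀, hi₀, hmin, hhead⟩ :=
    StartRule.exists_headOfLine (N := N) h.1.1 (Finset.card_pos.1 (by rw [← hQ]; omega))
  have h1 : ∑ i ∈ Q.erase i₀, (k - numLE (fun j => σ.start.finish ⟨a, d, u⟩ (i, j)) t) =
      (Q.erase i₀).card * k := by
    rw [← smul_eq_mul, ← Finset.sum_const]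
    refine Finset.sum_congr rfl fun i hi => ?_
    have hiQ := Finset.mem_of_mem_erase hi
    rw [hσ.numLE_eq_zero h hi₀ (lt_of_le_of_ne (hmin i hiQ) (Finset.ne_of_mem_erase hi).symm),
      Nat.sub_zero]
  have h2 := (StartRule.lt_departure_iff ENNReal.coe_ne_top).1 hhead.2.1
  rw [← Finset.sum_erase_add _ _ hi₀, h1, Finset.card_erase_of_mem hi₀, ← hQ]
  have h3 := Nat.mul_le_mul_right k (show r ≤ Q.card - 1 by omega)
  omega

/-! ### Greedy minimizes the backlog -/

lemma measurable_mk_sample (a : ℕ → ℝ≥0) (u : U) :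
    Measurable fun d : ℕ × Fin n → ℝ => (⟨a, d, u⟩ : Sample n U) := by
  refine measurable_comap_iff.2 ?_
  exact measurable_const.prodMk (measurable_id.prodMk measurable_const)

lemma measurable_startOf (σ : OnlineScheme L n k U) (a : ℕ → ℝ≥0) (u : U) (p : ℕ × Fin n) :
    Measurable fun d => σ.startOf a u d p :=
  (σ.measurable_start p).comp (measurable_mk_sample a u)

lemma measurable_backlogOf (σ : OnlineScheme L n k U) (N : ℕ) (a : ℕ → ℝ≥0) (u : U) (t : ℝ≥0) :
    Measurable (σ.backlogOf N a u t) :=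
  measurable_backlog (measurable_finishTime (σ.measurable_startOf a u)) measurable_const

lemma measure_backlogOf_crossing {μ : ℝ} (hμ : 0 < μ) (σ : OnlineScheme L n k U)
    (ha : Sample.IsArrivalPath a) (u : U) (m : ℕ) {s t : ℝ} (hs : 0 ≤ s) (hst : s ≤ t) :
    (Measure.infinitePi fun _ : ℕ × Fin n => expMeasure μ)
      {d | m ≤ σ.backlogOf N a u s.toNNReal d ∧ σ.backlogOf N a u t.toNNReal d < m} =
      ENNReal.ofReal μ * ∫⁻ τ in Set.Ioc s t,
        ∫⁻ d, {d | σ.backlogOf N a u τ.toNNReal d = m}.indicator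
          (fun d => (activeCount k N (σ.startOf a u) d τ.toNNReal : ℝ≥0∞)) d
          ∂(Measure.infinitePi fun _ : ℕ × Fin n => expMeasure μ) := by
  classical
  have := measure_backlog_crossing (N := N) (k := k) hμ (σ.causal ha u)
    (σ.measurable_startOf a u) m hs hst
  simp only [Set.indicator_apply]
  exact this

lemma measure_le_backlogOf_eq_add (P : Measure (ℕ × Fin n → ℝ)) (σ : OnlineScheme L n k U) (N : ℕ)
    (a : ℕ → ℝ≥0) (u : U) (t : ℝ≥0) (m : ℕ) :
    P {d | m ≤ σ.backlogOf N a u t d} =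
      P {d | σ.backlogOf N a u t d = m} + P {d | m + 1 ≤ σ.backlogOf N a u t d} := by
  rw [← measure_union]
  · congr 1
    ext d
    simp only [Set.mem_ofPred_eq, Set.mem_union]
    omega
  · refine Set.disjoint_left.2 fun d h1 h2 => ?_
    simp only [Set.mem_ofPred_eq] at h1 h2
    omega
  · exact measurableSet_le measurable_const (σ.measurable_backlogOf N a u _)

/-- `1` if a backlog of `m` chunks at time `t` includes chunks of a request in the system, and `0`
if it consists of chunks of future requests. This depends on the arrivals only, not on the
scheme. -/
noncomputable def busy (k N : ℕ) (a : ℕ → ℝ≥0) (m : ℕ) (t : ℝ≥0) : ℝ≥0∞ :=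
  if numFuture N a t * k < m then 1 else 0

lemma lintegral_const_mul_indicator_backlogOf (P : Measure (ℕ × Fin n → ℝ))
    (σ : OnlineScheme L n k U) (u : U) (m : ℕ) :
    ∫⁻ d, busy k N a m t * (L * {d | σ.backlogOf N a u t d = m}.indicator 1 d) ∂P =
      L * (busy k N a m t * P {d | σ.backlogOf N a u t d = m}) := by
  have hm : MeasurableSet {d | σ.backlogOf N a u t d = m} :=
    measurableSet_eq_fun (σ.measurable_backlogOf N a u t) measurable_const
  have h1 : Measurable ({d | σ.backlogOf N a u t d = m}.indicator (1 : (ℕ × Fin n → ℝ) → ℝ≥0∞)) :=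
    measurable_one.indicator hm
  rw [lintegral_const_mul _ (h1.const_mul _), lintegral_const_mul _ h1, lintegral_indicator_one hm]
  ring

/-- At most `L` threads are active, and none if no request is in the system. -/
lemma measure_backlogOf_crossing_le {μ : ℝ} (hμ : 0 < μ) (σ : OnlineScheme L n k U)
    (ha : Sample.IsArrivalPath a) (u : U) (N m : ℕ) {s t : ℝ} (hs : 0 ≤ s) (hst : s ≤ t) :
    (Measure.infinitePi fun _ : ℕ × Fin n => expMeasure μ)
      {d | m ≤ σ.backlogOf N a u s.toNNReal d ∧ σ.backlogOf N a u t.toNNReal d < m} ≤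
      ENNReal.ofReal μ * L * ∫⁻ τ in Set.Ioc s t, busy k N a m τ.toNNReal *
        (Measure.infinitePi fun _ : ℕ × Fin n => expMeasure μ)
          {d | σ.backlogOf N a u τ.toNNReal d = m} := by
  rw [measure_backlogOf_crossing hμ σ ha u m hs hst, mul_assoc,
    ← lintegral_const_mul' _ _ (ENNReal.natCast_ne_top L)]
  gcongr with τ
  rw [← lintegral_const_mul_indicator_backlogOf]
  refine lintegral_mono_ae ?_
  filter_upwards [ae_pos_infinitePi (ι := ℕ × Fin n) hμ] with d hd
  have hreg : Sample.Regular (⟨a, d, u⟩ : Sample n U) := ⟨ha, hd⟩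
  by_cases hm : d ∈ {d | σ.backlogOf N a u τ.toNNReal d = m}
  · rw [Set.indicator_of_mem hm, Set.indicator_of_mem hm, Pi.one_apply, mul_one]
    by_cases h0 : activeCount k N (σ.startOf a u) d τ.toNNReal = 0
    · simp [h0]
    · have := numFuture_mul_lt_backlogOf hreg h0
      rw [show σ.backlogOf N a u τ.toNNReal d = m from hm] at this
      rw [busy, if_pos this, one_mul]
      exact_mod_cast activeCount_le hreg
  · rw [Set.indicator_of_notMem hm]
    exact zero_le

/-- The greedy scheme has `L` active threads whenever a request is in the system. -/
lemma IsGreedy.le_measure_backlogOf_crossing {μ : ℝ} (hμ : 0 < μ) {σ : OnlineScheme L n k U}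
    (hσ : σ.IsGreedy) (ha : Sample.IsArrivalPath a) (u : U) (N m : ℕ) {s t : ℝ} (hs : 0 ≤ s)
    (hst : s ≤ t) :
    ENNReal.ofReal μ * L * ∫⁻ τ in Set.Ioc s t, busy k N a m τ.toNNReal *
        (Measure.infinitePi fun _ : ℕ × Fin n => expMeasure μ)
          {d | σ.backlogOf N a u τ.toNNReal d = m} ≤
      (Measure.infinitePi fun _ : ℕ × Fin n => expMeasure μ)
      {d | m ≤ σ.backlogOf N a u s.toNNReal d ∧ σ.backlogOf N a u t.toNNReal d < m} := by
  rw [measure_backlogOf_crossing hμ σ ha u m hs hst, mul_assoc,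
    ← lintegral_const_mul' _ _ (ENNReal.natCast_ne_top L)]
  gcongr with τ
  rw [← lintegral_const_mul_indicator_backlogOf]
  refine lintegral_mono_ae ?_
  filter_upwards [ae_pos_infinitePi (ι := ℕ × Fin n) hμ] with d hd
  have hreg : Sample.Regular (⟨a, d, u⟩ : Sample n U) := ⟨ha, hd⟩
  by_cases hm : d ∈ {d | σ.backlogOf N a u τ.toNNReal d = m}
  · rw [Set.indicator_of_mem hm, Set.indicator_of_mem hm, Pi.one_apply, mul_one, busy]
    split_ifs with hlt
    · rw [one_mul]
      rw [← show σ.backlogOf N a u τ.toNNReal d = m from hm] at hlt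
      exact_mod_cast hσ.le_activeCount hreg hlt
    · simp
  · rw [Set.indicator_of_notMem hm, Set.indicator_of_notMem hm]
    simp

lemma backlogOf_antitone (σ : OnlineScheme L n k U) (a : ℕ → ℝ≥0) (u : U) (d : ℕ × Fin n → ℝ)
    {s t : ℝ} (hst : s ≤ t) :
    σ.backlogOf N a u t.toNNReal d ≤ σ.backlogOf N a u s.toNNReal d :=
  backlog_antitone (ENNReal.coe_le_coe.2 (Real.toNNReal_le_toNNReal hst))

lemma backlogOf_zero (hd : ∀ p, 0 < d p) : σ.backlogOf N a u 0 d = N * k := by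
  have : ∀ i, numLE (fun j => finishTime (σ.startOf a u) d (i, j)) 0 = 0 := fun i =>
    Finset.card_eq_zero.2 (Finset.filter_eq_empty_iff.2 fun j _ => not_le.2
      ((ENNReal.ofReal_pos.2 (hd (i, j))).trans_le le_add_self))
  simp [backlogOf, backlog, this]

/-- Whatever the arrivals, the backlog under a greedy scheme is stochastically smaller than under
any other scheme at any time. -/
lemma IsGreedy.measure_le_backlogOf {V : Type*} [MeasurableSpace V] {μ : ℝ} (hμ : 0 < μ)
    {g : OnlineScheme L n k U} (hg : g.IsGreedy) (σ : OnlineScheme L n k V)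
    (ha : Sample.IsArrivalPath a) (u : U) (v : V) (N m : ℕ) {t : ℝ} (ht : 0 ≤ t) :
    (Measure.infinitePi fun _ : ℕ × Fin n => expMeasure μ)
        {d | m ≤ g.backlogOf N a u t.toNNReal d} ≤
      (Measure.infinitePi fun _ : ℕ × Fin n => expMeasure μ)
        {d | m ≤ σ.backlogOf N a v t.toNNReal d} := by
  have : IsProbabilityMeasure (expMeasure μ) := isProbabilityMeasure_expMeasure hμ
  set P := Measure.infinitePi fun _ : ℕ × Fin n => expMeasure μ with hP
  refine tail_le_tail_of_drift (c := ENNReal.ofReal μ * L)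
    (χ := fun m τ => busy k N a m τ.toNNReal)
    (u := fun m τ => P {d | m ≤ σ.backlogOf N a v τ.toNNReal d})
    (pu := fun m τ => P {d | σ.backlogOf N a v τ.toNNReal d = m})
    (g := fun m τ => P {d | m ≤ g.backlogOf N a u τ.toNNReal d})
    (pg := fun m τ => P {d | g.backlogOf N a u τ.toNNReal d = m}) (M := N * k + 1)
    (ENNReal.mul_ne_top ENNReal.ofReal_ne_top (ENNReal.natCast_ne_top L)) (fun m τ => ?_)
    (fun m τ => prob_le_one) (fun m τ => measure_le_backlogOf_eq_add P σ N a v _ m)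
    (fun m τ => measure_le_backlogOf_eq_add P g N a u _ m) (fun m => ?_) (fun m hm τ => ?_)
    (fun m s t hs hst => ?_) (fun m s t hs hst => ?_) m ht
  · unfold busy
    split_ifs <;> simp
  · refine measure_mono_ae ?_
    filter_upwards [ae_pos_infinitePi (ι := ℕ × Fin n) hμ] with d hd hle
    change m ≤ σ.backlogOf N a v (Real.toNNReal 0) d
    rw [Real.toNNReal_zero, backlogOf_zero hd]
    exact le_trans hle (backlog_le _ _)
  · rw [show {d | m ≤ g.backlogOf N a u τ.toNNReal d} = ∅ from
      Set.eq_empty_of_forall_notMem fun d hd => ?_, measure_empty]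
    exact absurd (hm.trans (le_trans hd (backlog_le _ _))) (by omega)
  · refine le_trans (le_trans (measure_mono fun d hd => ?_) (measure_union_le
      {d | m ≤ σ.backlogOf N a v t.toNNReal d} {d | m ≤ σ.backlogOf N a v s.toNNReal d ∧
        σ.backlogOf N a v t.toNNReal d < m})) (add_le_add_right
          (measure_backlogOf_crossing_le hμ σ ha v N m hs hst) _)
    by_cases h : m ≤ σ.backlogOf N a v t.toNNReal d
    · exact Or.inl h
    · exact Or.inr ⟨hd, not_le.1 h⟩
  · refine le_trans (add_le_add_right
      (hg.le_measure_backlogOf_crossing hμ ha u N m hs hst) _) ?_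
    rw [← measure_union]
    · refine measure_mono ?_
      rintro d (h | h)
      · exact le_trans h (backlogOf_antitone g a u d hst)
      · exact h.1
    · exact Set.disjoint_left.2 fun d h1 h2 => absurd h1 (not_le.2 h2.2)
    · exact (measurableSet_le measurable_const (g.measurable_backlogOf N a u _)).inter
        (measurableSet_lt (g.measurable_backlogOf N a u _) measurable_const)

/-! ### From the queue length to the delay -/

lemma lintegral_card_eq_sum {α : Type*} [MeasurableSpace α] (P : Measure α) {Q : α → ℕ}
    (hQ : Measurable Q) {N : ℕ} (hN : ∀ x, Q x ≤ N) :
    ∫⁻ x, (Q x : ℝ≥0∞) ∂P = ∑ r ∈ Finset.range N, P {x | r < Q x} := by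
  have hm : ∀ r, MeasurableSet {x | r < Q x} := fun r => measurableSet_lt measurable_const hQ
  have : ∀ x, (Q x : ℝ≥0∞) = ∑ r ∈ Finset.range N, {x | r < Q x}.indicator 1 x := by
    intro x
    simp only [Set.indicator_apply, Set.mem_ofPred_eq, Pi.one_apply, Finset.sum_boole]
    congr 1
    have : (Finset.range N).filter (fun r => r < Q x) = Finset.range (Q x) := by
      ext r
      simpa using fun h => h.trans_le (hN x)
    rw [this, Finset.card_range]
  simp only [this]
  rw [lintegral_finsetSum _ fun r _ => measurable_one.indicator (hm r)]
  exact Finset.sum_congr rfl fun r _ => lintegral_indicator_one (hm r)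

lemma measurable_departure (σ : OnlineScheme L n k U) (i : ℕ) :
    Measurable fun ω => σ.start.departure k ω i :=
  measurable_orderStat k fun j => (σ.measurable_start (i, j)).add
    (Sample.measurable_dl (i, j)).ennreal_ofReal

lemma measurable_delay (σ : OnlineScheme L n k U) (i : ℕ) :
    Measurable fun ω => σ.start.delay k ω i :=
  (σ.measurable_departure i).sub (Sample.measurable_arr i).coe_nnreal_ennreal

lemma measurable_card_pending (σ : OnlineScheme L n k U) (N : ℕ) :
    Measurable fun z : Sample n U × ℝ =>
      (σ.start.pending k N z.1 z.2.toNNReal).card := by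
  classical
  unfold StartRule.pending
  simp only [Finset.card_filter]
  refine Finset.measurable_sum _ fun i _ => Measurable.ite ?_ measurable_const measurable_const
  exact (measurableSet_le ((Sample.measurable_arr i).comp measurable_fst)
    measurable_snd.real_toNNReal).inter (measurableSet_lt
    measurable_snd.real_toNNReal.coe_nnreal_ennreal
    ((σ.measurable_departure i).comp measurable_fst))

lemma volume_between (b : ℝ≥0) (D : ℝ≥0∞) :
    volume {τ : ℝ | 0 ≤ τ ∧ b ≤ τ.toNNReal ∧ (τ.toNNReal : ℝ≥0∞) < D} = D - b := by
  induction D with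
  | top =>
    have : {τ : ℝ | 0 ≤ τ ∧ b ≤ τ.toNNReal ∧ (τ.toNNReal : ℝ≥0∞) < ⊤} = Set.Ici (b : ℝ) := by
      ext τ
      simp only [ENNReal.coe_lt_top, and_true, Set.mem_ofPred_eq, Set.mem_Ici]
      constructor
      · rintro ⟨h0, h⟩
        exact (Real.le_toNNReal_iff_coe_le h0).1 h
      · intro h
        have h0 := b.coe_nonneg.trans h
        exact ⟨h0, (Real.le_toNNReal_iff_coe_le h0).2 h⟩
    rw [this, Real.volume_Ici, ENNReal.top_sub_coe]
  | coe D =>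
    have : {τ : ℝ | 0 ≤ τ ∧ b ≤ τ.toNNReal ∧ (τ.toNNReal : ℝ≥0∞) < D} = Set.Ico (b : ℝ) D := by
      ext τ
      simp only [ENNReal.coe_lt_coe, Set.mem_ofPred_eq, Set.mem_Ico]
      constructor
      · rintro ⟨h0, h, h'⟩
        exact ⟨(Real.le_toNNReal_iff_coe_le h0).1 h, (Real.toNNReal_lt_iff_lt_coe h0).1 h'⟩
      · rintro ⟨h, h'⟩
        have h0 := b.coe_nonneg.trans h
        exact ⟨h0, (Real.le_toNNReal_iff_coe_le h0).2 h, (Real.toNNReal_lt_iff_lt_coe h0).2 h'⟩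
    rw [this, Real.volume_Ico, ← ENNReal.coe_sub, ENNReal.ofReal, NNReal.sub_def]

/-- The total delay is the time integral of the queue length. -/
lemma sum_delay_eq_lintegral (σ : OnlineScheme L n k U) (N : ℕ) (ω : Sample n U) :
    ∑ i ∈ Finset.range N, σ.start.delay k ω i =
      ∫⁻ τ in Set.Ici (0 : ℝ), ((σ.start.pending k N ω τ.toNNReal).card : ℝ≥0∞) := by
  classical
  have hm : ∀ i, MeasurableSet {τ : ℝ | 0 ≤ τ ∧ ω.arr i ≤ τ.toNNReal ∧
      (τ.toNNReal : ℝ≥0∞) < σ.start.departure k ω i} := fun i =>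
    (measurableSet_le measurable_const measurable_id).inter
      ((measurableSet_le measurable_const measurable_real_toNNReal).inter
        (measurableSet_lt measurable_real_toNNReal.coe_nnreal_ennreal measurable_const))
  calc ∑ i ∈ Finset.range N, σ.start.delay k ω i
      = ∑ i ∈ Finset.range N, ∫⁻ τ : ℝ, {τ : ℝ | 0 ≤ τ ∧ ω.arr i ≤ τ.toNNReal ∧
          (τ.toNNReal : ℝ≥0∞) < σ.start.departure k ω i}.indicator 1 τ := by
        refine Finset.sum_congr rfl fun i _ => ?_
        rw [lintegral_indicator_one (hm i), volume_between]
        rfl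
    _ = ∫⁻ τ : ℝ, ∑ i ∈ Finset.range N, {τ : ℝ | 0 ≤ τ ∧ ω.arr i ≤ τ.toNNReal ∧
          (τ.toNNReal : ℝ≥0∞) < σ.start.departure k ω i}.indicator 1 τ :=
        (lintegral_finsetSum _ fun i _ => measurable_one.indicator (hm i)).symm
    _ = _ := by
        rw [← lintegral_indicator measurableSet_Ici]
        refine lintegral_congr fun τ => ?_
        by_cases h : 0 ≤ τ
        · rw [Set.indicator_of_mem (Set.mem_Ici.2 h), StartRule.pending, Finset.card_filter,
            Nat.cast_sum]
          refine Finset.sum_congr rfl fun i _ => ?_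
          simp [Set.indicator_apply, h]
        · rw [Set.indicator_of_notMem (by simpa using h)]
          exact Finset.sum_eq_zero fun i _ => Set.indicator_of_notMem (fun h' => h h'.1) _

/-- For any arrivals, the expected total delay of the first `N` requests is least under a greedy
scheme. -/
lemma IsGreedy.lintegral_sum_delay_le {V : Type*} [MeasurableSpace V] {μ : ℝ} (hμ : 0 < μ)
    {g : OnlineScheme L n k U} (hg : g.IsGreedy) (σ : OnlineScheme L n k V)
    (ha : Sample.IsArrivalPath a) (u : U) (v : V) (N : ℕ) :
    ∫⁻ d, ∑ i ∈ Finset.range N, g.start.delay k ⟨a, d, u⟩ i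
        ∂(Measure.infinitePi fun _ : ℕ × Fin n => expMeasure μ) ≤
      ∫⁻ d, ∑ i ∈ Finset.range N, σ.start.delay k ⟨a, d, v⟩ i
        ∂(Measure.infinitePi fun _ : ℕ × Fin n => expMeasure μ) := by
  have : IsProbabilityMeasure (expMeasure μ) := isProbabilityMeasure_expMeasure hμ
  simp only [sum_delay_eq_lintegral]
  have hQ : Measurable fun z : (ℕ × Fin n → ℝ) × ℝ =>
      (g.start.pending k N ⟨a, z.1, u⟩ z.2.toNNReal).card :=
    (g.measurable_card_pending N).comp
      (((measurable_mk_sample a u).comp measurable_fst).prodMk measurable_snd)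
  have hQ' : Measurable fun z : (ℕ × Fin n → ℝ) × ℝ =>
      (σ.start.pending k N ⟨a, z.1, v⟩ z.2.toNNReal).card :=
    (σ.measurable_card_pending N).comp
      (((measurable_mk_sample a v).comp measurable_fst).prodMk measurable_snd)
  have hcast : ∀ {Q : (ℕ × Fin n → ℝ) × ℝ → ℕ}, Measurable Q →
      Measurable fun z => (Q z : ℝ≥0∞) := fun h => measurable_from_top.comp h
  refine (lintegral_lintegral_swap (hcast hQ).aemeasurable).trans_le
    (le_of_le_of_eq ?_ (lintegral_lintegral_swap (hcast hQ').aemeasurable).symm)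
  refine setLIntegral_mono' measurableSet_Ici fun τ hτ => ?_
  have hQτ : Measurable fun d => (g.start.pending k N ⟨a, d, u⟩ τ.toNNReal).card :=
    hQ.comp measurable_prodMk_right
  have hQτ' : Measurable fun d => (σ.start.pending k N ⟨a, d, v⟩ τ.toNNReal).card :=
    hQ'.comp measurable_prodMk_right
  rw [lintegral_card_eq_sum _ hQτ fun d => StartRule.card_pending_le,
    lintegral_card_eq_sum _ hQτ' fun d => StartRule.card_pending_le]
  refine Finset.sum_le_sum fun r _ => ?_
  have hpos := ae_pos_infinitePi (ι := ℕ × Fin n) hμ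
  refine le_trans (measure_mono_ae ?_) (le_trans (hg.measure_le_backlogOf hμ σ ha u v N
    (numFuture N a τ.toNNReal * k + r * k + 1) hτ) (measure_mono_ae ?_))
  · filter_upwards [hpos] with d hd h
    exact hg.le_backlogOf ⟨ha, hd⟩ h
  · filter_upwards [hpos] with d hd h
    exact lt_card_pending ⟨ha, hd⟩ h

end OnlineScheme

/-! ### Averaging over the arrivals and the seed -/

lemma measurable_numArrivals (T : ℝ≥0) : Measurable fun a : ℕ → ℝ≥0 => numArrivals a T := by
  have h : ∀ a : ℕ → ℝ≥0, numArrivals a T =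
      ⌊(∑' i, if a i ≤ T then (1 : ℝ≥0∞) else 0).toReal⌋₊ := by
    intro a
    have : ∑' i, (if a i ≤ T then (1 : ℝ≥0∞) else 0) = ({i | a i ≤ T}.encard : ℝ≥0∞) := by
      rw [← ENNReal.tsum_set_one, tsum_subtype {i | a i ≤ T} fun _ => (1 : ℝ≥0∞)]
      exact tsum_congr fun i => by simp [Set.indicator_apply]
    rw [this, numArrivals]
    rcases Set.finite_or_infinite {i | a i ≤ T} with hf | hi
    · rw [← hf.cast_ncard_eq]
      simp
    · rw [hi.ncard, hi.encard_eq]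
      simp
  simp only [h]
  exact Nat.measurable_floor.comp (Measurable.tsum fun i => Measurable.ite
    (measurableSet_le (measurable_pi_apply i) measurable_const) measurable_const
    measurable_const).ennreal_toReal

lemma measurable_mk_triple {n : ℕ} {U : Type*} [MeasurableSpace U] :
    Measurable fun x : (ℕ → ℝ≥0) × (ℕ × Fin n → ℝ) × U => (⟨x.1, x.2.1, x.2.2⟩ : Sample n U) :=
  measurable_comap_iff.2 measurable_id

lemma lintegral_sampleLaw {n : ℕ} {U : Type*} [MeasurableSpace U] {μ : ℝ} (hμ : 0 < μ)
    (α : Measure (ℕ → ℝ≥0)) (ν : Measure U) [IsProbabilityMeasure ν]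
    {F : Sample n U → ℝ≥0∞} (hF : Measurable F) :
    ∫⁻ ω, F ω ∂(sampleLaw n μ α ν) =
      ∫⁻ a, ∫⁻ u, ∫⁻ d, F ⟨a, d, u⟩ ∂(Measure.infinitePi fun _ => expMeasure μ) ∂ν ∂α := by
  have : IsProbabilityMeasure (expMeasure μ) := isProbabilityMeasure_expMeasure hμ
  have hm : Measurable fun x : (ℕ → ℝ≥0) × (ℕ × Fin n → ℝ) × U =>
      F ⟨x.1, x.2.1, x.2.2⟩ := hF.comp measurable_mk_triple
  rw [sampleLaw, lintegral_map hF measurable_mk_triple, lintegral_prod _ hm.aemeasurable]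
  refine lintegral_congr fun a => ?_
  exact lintegral_prod_symm _ (hm.comp measurable_prodMk_left).aemeasurable

/-- Expectations can be compared for given arrivals and seeds. -/
lemma lintegral_sampleLaw_le {n : ℕ} {U V : Type*} [MeasurableSpace U] [MeasurableSpace V] {μ : ℝ}
    (hμ : 0 < μ) (α : Measure (ℕ → ℝ≥0)) (hα : ∀ᵐ a ∂α, Sample.IsArrivalPath a)
    (νg : Measure U) [IsProbabilityMeasure νg] (ν : Measure V) [IsProbabilityMeasure ν]
    {F : Sample n U → ℝ≥0∞} {G : Sample n V → ℝ≥0∞} (hF : Measurable F) (hG : Measurable G)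
    (h : ∀ a, Sample.IsArrivalPath a → ∀ u v,
      ∫⁻ d, F ⟨a, d, u⟩ ∂(Measure.infinitePi fun _ => expMeasure μ) ≤
        ∫⁻ d, G ⟨a, d, v⟩ ∂(Measure.infinitePi fun _ => expMeasure μ)) :
    ∫⁻ ω, F ω ∂(sampleLaw n μ α νg) ≤ ∫⁻ ω, G ω ∂(sampleLaw n μ α ν) := by
  rw [lintegral_sampleLaw hμ α νg hF, lintegral_sampleLaw hμ α ν hG]
  refine lintegral_mono_ae ?_
  filter_upwards [hα] with a ha
  have h1 : ∀ u, ∫⁻ d, F ⟨a, d, u⟩ ∂(Measure.infinitePi fun _ => expMeasure μ) ≤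
      ∫⁻ v, ∫⁻ d, G ⟨a, d, v⟩ ∂(Measure.infinitePi fun _ => expMeasure μ) ∂ν := by
    intro u
    have := lintegral_mono (μ := ν) fun v => h a ha u v
    rwa [lintegral_const, measure_univ, mul_one] at this
  have := lintegral_mono (μ := νg) h1
  rwa [lintegral_const, measure_univ, mul_one] at this

namespace OnlineScheme

variable {L n k : ℕ} {U V : Type*} [MeasurableSpace U] [MeasurableSpace V] {μ : ℝ}
  {g : OnlineScheme L n k U} {α : Measure (ℕ → ℝ≥0)} {νg : Measure U} {ν : Measure V}

lemma measurable_comp_nat {β : Type*} [MeasurableSpace β] {Φ : ℕ → β → ℝ≥0∞}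
    (hΦ : ∀ N, Measurable (Φ N)) {N : β → ℕ} (hN : Measurable N) :
    Measurable fun x => Φ (N x) x :=
  (measurable_from_prod_countable_left (f := fun z : β × ℕ => Φ z.2 z.1) hΦ).comp
    (measurable_id.prodMk hN)

lemma measurable_average_delay (σ : OnlineScheme L n k U) (T : ℝ≥0) :
    Measurable fun ω => (∑ i ∈ Finset.range (numArrivals ω.arr T), σ.start.delay k ω i) /
      (numArrivals ω.arr T : ℝ≥0∞) := by
  have h1 : ∀ N : ℕ, Measurable fun ω : Sample n U =>
      (∑ i ∈ Finset.range N, σ.start.delay k ω i) / (N : ℝ≥0∞) := fun N =>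
    (Finset.measurable_sum _ fun i _ => σ.measurable_delay i).div_const _
  have h2 : Measurable fun ω : Sample n U => numArrivals ω.arr T :=
    (measurable_numArrivals T).comp (measurable_fst.comp Sample.measurable_toTriple)
  exact measurable_comp_nat h1 h2

lemma measurable_sum_delay (σ : OnlineScheme L n k U) (a : ℕ → ℝ≥0) (u : U) (N : ℕ) :
    Measurable fun d : ℕ × Fin n → ℝ => ∑ i ∈ Finset.range N, σ.start.delay k ⟨a, d, u⟩ i :=
  Finset.measurable_sum _ fun i _ => (σ.measurable_delay i).comp (measurable_mk_sample a u)

lemma IsGreedy.horizonDelay_le (hμ : 0 < μ) (hg : g.IsGreedy) (σ : OnlineScheme L n k V)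
    (hα : ∀ᵐ a ∂α, Sample.IsArrivalPath a) [IsProbabilityMeasure νg] [IsProbabilityMeasure ν]
    (T : ℝ≥0) : g.horizonDelay μ α νg T ≤ σ.horizonDelay μ α ν T := by
  refine lintegral_sampleLaw_le hμ α hα νg ν (g.measurable_average_delay T)
    (σ.measurable_average_delay T) fun a ha u v => ?_
  simp only [div_eq_mul_inv]
  rw [lintegral_mul_const _ (g.measurable_sum_delay a u _),
    lintegral_mul_const _ (σ.measurable_sum_delay a v _)]
  exact mul_le_mul_left (hg.lintegral_sum_delay_le hμ σ ha u v _) _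

lemma IsGreedy.requestDelay_le (hμ : 0 < μ) (hg : g.IsGreedy) (σ : OnlineScheme L n k V)
    (hα : ∀ᵐ a ∂α, Sample.IsArrivalPath a) [IsProbabilityMeasure νg] [IsProbabilityMeasure ν]
    (N : ℕ) : g.requestDelay μ α νg N ≤ σ.requestDelay μ α ν N := by
  unfold requestDelay
  rw [← lintegral_finsetSum _ fun i _ => g.measurable_delay i,
    ← lintegral_finsetSum _ fun i _ => σ.measurable_delay i]
  gcongr
  exact lintegral_sampleLaw_le hμ α hα νg ν
    (Finset.measurable_sum _ fun i _ => g.measurable_delay i)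
    (Finset.measurable_sum _ fun i _ => σ.measurable_delay i)
    fun a ha u v => hg.lintegral_sum_delay_le hμ σ ha u v N

end OnlineScheme

theorem theorem3 {L n k : ℕ} (hk : 1 < k) (hn : L + k - 1 ≤ n) {μ : ℝ} (hμ : 0 < μ) :
    (∃ g : OnlineScheme L n k Unit, g.IsGreedy) ∧
    ∀ {U V : Type*} [MeasurableSpace U] [MeasurableSpace V]
      (α : Measure (ℕ → ℝ≥0)) [IsProbabilityMeasure α]
      (_ : ∀ᵐ a ∂α, Sample.IsArrivalPath a)
      (νg : Measure U) [IsProbabilityMeasure νg] (ν : Measure V) [IsProbabilityMeasure ν]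
      (g : OnlineScheme L n k U) (_ : g.IsGreedy) (σ : OnlineScheme L n k V),
      limsup (g.horizonDelay μ α νg) atTop ≤ limsup (σ.horizonDelay μ α ν) atTop ∧
      liminf (g.horizonDelay μ α νg) atTop ≤ liminf (σ.horizonDelay μ α ν) atTop ∧
      limsup (g.requestDelay μ α νg) atTop ≤ limsup (σ.requestDelay μ α ν) atTop ∧
      liminf (g.requestDelay μ α νg) atTop ≤ liminf (σ.requestDelay μ α ν) atTop := by
  refine ⟨⟨greedyScheme L n k Unit hk.le, isGreedy_greedyScheme hk.le hn⟩, ?_⟩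
  intro U V _ _ α _ hα νg _ ν _ g hg σ
  have h1 := Eventually.of_forall (f := atTop) fun T =>
    hg.horizonDelay_le (νg := νg) (ν := ν) hμ σ hα T
  have h2 := Eventually.of_forall (f := atTop) fun N =>
    hg.requestDelay_le (νg := νg) (ν := ν) hμ σ hα N
  exact ⟨limsup_le_limsup h1, liminf_le_liminf h1, limsup_le_limsup h2, liminf_le_liminf h2⟩
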